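/- Let $F_0$ be a complete discretely valued field with ring of integers $O_{F_0}$, uniformizer $\pi_0$ and perfect residue field of characteristic $\neq 2$. Let $F/F_0$ be a ramified quadratic extension with ring of integers $O_F$ and a uniformizer $\pi$ with $\pi^2=\pi_0$. Let $V$ be an $F$-vector space of dimension $n=2m$ with an $F/F_0$-hermitian form $\phi$ and a basis $e_1,\dots,e_n$ with $\phi(e_i,e_{n+1-j})=\delta_{i,j}$. Put $(x,y)=\tfrac12\mathrm{Tr}_{F/F_0}\phi(x,y)$ and $\Lambda_m=\mathrm{span}_{O_F}\{\pi^{-1}e_1,\dots,\pi^{-1}e_m,e_{m+1},\dots,e_n\}$, on which $(\ ,\ )$ takes values in $O_{F_0}$; let $t$ denote multiplication by $\pi$ on $\Lambda_m$, and let $$\Lambda'=\mathrm{span}_{O_{F_0}}\{-\pi^{-1}e_1,-e_1,\dots,-e_m,\pi e_{m+1},\dots,\pi e_{n-1}\}\subset\Lambda_m .$$ Let $n=r+s$ with $2\le s\le r$. Let $\mathcal M$ be the naive splitting model of signature $(r,s)$, i.e. the moduli scheme over $O_F$ whose points over an $O_F$-scheme $S$ are the pairs $(\mathcal F_0,\mathcal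 F_1)$ of $\mathcal O_S$-submodules of $\Lambda_m\otimes_{O_{F_0}}\mathcal O_S$, Zariski locally direct summands of ranks $s$ and $n$, such that $\mathcal F_0\subset\mathcal F_1$, $\mathcal F_1=\mathcal F_1^\perp$ for $(\ ,\ )\otimes\mathcal O_S$, $(t+\pi)\mathcal F_1\subset\mathcal F_0$ and $(t-\pi)\mathcal F_0=0$. For distinct indices $i_2,\dots,i_s\in\{1,\dots,n-2\}$ let $D$ and $M_2=(a_{k,j})$ be matrices of indeterminates of sizes $(s-1)\times(s-1)$ and $(n-2)\times s$, let $M_2'$ be the $(s-1)\times s$ submatrix of $M_2$ formed by the rows $i_2,\dots,i_s$, let $Q=(q_{i,j})_{2\le i,j\le s}$ with $$q_{i,j}=\sum_{k=1}^{m-1}\bigl(a_{k,i}\,a_{n-1-k,j}-a_{n-1-k,i}\,a_{k,j}\bigr),$$ and let $I$ be the ideal of $O_F[D,M_2]$ generated by the entries of $$M_2'-[\mathbf 0\mid I_{s-1}],\qquad D+D^t,\qquad D\cdot Q+2\pi I_{s-1},$$ where $[\mathbf 0\mid I_{s-1}]$ has first column $0$. Then for every choice of $i_2,\dots,i_s$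 there is an affine open subscheme ${}_2\mathcal U_{r,s}\subset\mathcal M$ isomorphic over $O_F$ to $$\mathbb A^{s}_{O_F}\times_{\operatorname{Spec}O_F}\operatorname{Spec}O_F[D,M_2]/I ,$$ and these charts can be chosen such that over every field $\kappa$ over the residue field of $O_F$ each of them contains a point of the form $(\mathcal F_0,\Lambda'\otimes\kappa)$, and such that for every field $\kappa$ over $O_F$ each $\kappa$-point of $\mathcal M$ of the form $(\mathcal F_0,\Lambda'\otimes\kappa)$ lies in the chart of some choice of $i_2,\dots,i_s$. -/

import Mathlib

open CategoryTheory CategoryTheory.Limits AlgebraicGeometry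
open scoped TensorProduct

universe u

set_option linter.unusedSectionVars false

noncomputable section

/-! ### The split hermitian space -/

/-- The data attached to a ramified quadratic extension `F / F₀` with rings of integers `OF`, `O₀`:
uniformizers `ϖ` (the element `π`) and `π₀ = π ^ 2`, the nontrivial automorphism `σ` of `F / F₀`,
and an `F / F₀`-hermitian form `φ` (linear in the first and `σ`-linear in the second variable) on
`V` with a basis `e` in which it is split. The index `i : Fin (2 * m)` stands for `i + 1`
in `{1, …, n}`, `n = 2 * m`, so that `i.rev` stands for `n + 1 - (i + 1)`. -/
structure SplitHermitian (O₀ F₀ OF F V : Type u)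
    [CommRing O₀] [IsDomain O₀] [IsDiscreteValuationRing O₀]
    [Field F₀] [Algebra O₀ F₀] [CommRing OF] [Field F] [Algebra F₀ F] [Algebra O₀ OF]
    [Algebra OF F] [AddCommGroup V] [Module F V] (m : ℕ) where
  /-- the residue characteristic is not two -/
  residue_two_ne_zero : (2 : IsLocalRing.ResidueField O₀) ≠ 0
  finrank_eq : Module.finrank F₀ F = 2
  π₀ : O₀
  irreducible_π₀ : Irreducible π₀
  ϖ : OF
  ϖ_sq : ϖ ^ 2 = algebraMap O₀ OF π₀
  σ : F ≃ₐ[F₀] F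
  σ_ne : σ ≠ AlgEquiv.refl
  φ : V →ₗ[F] V →ₛₗ[(σ : F →+* F)] F
  hermitian : ∀ x y, φ y x = σ (φ x y)
  e : Module.Basis (Fin (2 * m)) F V
  split : ∀ i j, φ (e i) (e j.rev) = if i = j then 1 else 0

namespace SplitHermitian

variable {O₀ F₀ OF F V : Type u}
  [CommRing O₀] [IsDomain O₀] [IsDiscreteValuationRing O₀]
  [Field F₀] [Algebra O₀ F₀] [IsFractionRing O₀ F₀]
  [Field F] [Algebra F₀ F] [Algebra O₀ F] [IsScalarTower O₀ F₀ F]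
  [CommRing OF] [Algebra O₀ OF] [Algebra OF F] [IsScalarTower O₀ OF F] [IsIntegralClosure OF O₀ F]
  [AddCommGroup V] [Module F V] [Module OF V] [IsScalarTower OF F V]
  [Module O₀ V] [IsScalarTower O₀ OF V] {m : ℕ}

section lattice

variable (H : SplitHermitian O₀ F₀ OF F V m)

/-- The uniformizer `π`, as an element of `F`. -/
def pi : F := algebraMap OF F H.ϖ

/-- The generators `π⁻¹ e_1, …, π⁻¹ e_m, e_{m+1}, …, e_n` of `Λ_m`. -/
def gen (i : Fin (2 * m)) : V := if (i : ℕ) < m then H.pi⁻¹ • H.e i else H.e i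

/-- The lattice `Λ_m`, as an `O_F`-module. -/
def latticeM : Submodule OF V := Submodule.span OF (Set.range H.gen)

/-- The `O_{F₀}`-submodule `Λ'` of `Λ_m` spanned by
`-π⁻¹ e_1, -e_1, …, -e_m, π e_{m+1}, …, π e_{n-1}`. -/
def lambdaPrime : Submodule O₀ H.latticeM :=
  (Submodule.span O₀
    ({v : V | ∃ i : Fin (2 * m), (i : ℕ) = 0 ∧ v = -(H.pi⁻¹ • H.e i)} ∪
     {v : V | ∃ i : Fin (2 * m), (i : ℕ) < m ∧ v = -H.e i} ∪
     {v : V | ∃ i : Fin (2 * m), m ≤ (i : ℕ) ∧ (i : ℕ) + 1 < 2 * m ∧ v = H.pi • H.e i})).comap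
    (H.latticeM.subtype.restrictScalars O₀)

/-- The form `( x , y ) = ½ Tr_{F/F₀} φ(x, y)` on `V`. -/
def symForm (x y : V) : F₀ := (2 : F₀)⁻¹ * Algebra.trace F₀ F (H.φ x y)

end lattice

section integrality

variable (H : SplitHermitian O₀ F₀ OF F V m)

theorem pi_sq : H.pi ^ 2 = algebraMap F₀ F (algebraMap O₀ F₀ H.π₀) := by
  rw [pi, ← map_pow, H.ϖ_sq, ← IsScalarTower.algebraMap_apply, ← IsScalarTower.algebraMap_apply]

theorem pi_ne_zero : H.pi ≠ 0 := by
  intro h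
  have h1 := H.pi_sq
  rw [h, zero_pow two_ne_zero] at h1
  have h2 := (map_eq_zero (algebraMap F₀ F)).1 h1.symm
  exact H.irreducible_π₀.ne_zero
    ((map_eq_zero_iff _ (IsFractionRing.injective O₀ F₀)).1 h2)

theorem isUnit_two (H : SplitHermitian O₀ F₀ OF F V m) : IsUnit (2 : O₀) := by
  by_contra h
  apply H.residue_two_ne_zero
  have h1 : (2 : O₀) ∈ IsLocalRing.maximalIdeal O₀ := h
  exact (map_ofNat (IsLocalRing.residue O₀) 2).symm.trans
    ((IsLocalRing.residue_eq_zero_iff (2 : O₀)).2 h1)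

theorem two_ne_zero' (H : SplitHermitian O₀ F₀ OF F V m) : (2 : F₀) ≠ 0 := by
  have h := (H.isUnit_two.map (algebraMap O₀ F₀)).ne_zero
  rwa [map_ofNat] at h

theorem trace_eq (z : F) : algebraMap F₀ F (Algebra.trace F₀ F z) = z + H.σ z := by
  classical
  have hfd : FiniteDimensional F₀ F :=
    Module.finite_of_finrank_pos (by rw [H.finrank_eq]; norm_num)
  have hne : (AlgEquiv.refl : F ≃ₐ[F₀] F) ≠ H.σ := fun h => H.σ_ne h.symm
  have hle : Fintype.card (F ≃ₐ[F₀] F) ≤ 2 := by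
    simpa [H.finrank_eq] using AlgEquiv.card_le (F := F₀) (K := F)
  have hpair : ({AlgEquiv.refl, H.σ} : Finset (F ≃ₐ[F₀] F)).card = 2 := Finset.card_pair hne
  have huniv : ({AlgEquiv.refl, H.σ} : Finset (F ≃ₐ[F₀] F)) = Finset.univ :=
    Finset.eq_of_subset_of_card_le (Finset.subset_univ _) (by rw [hpair]; exact hle)
  have hcard : Nat.card (F ≃ₐ[F₀] F) = 2 := by
    rw [Nat.card_eq_fintype_card, ← Finset.card_univ, ← huniv, hpair]
  have : IsGalois F₀ F := IsGalois.of_card_aut_eq_finrank _ _ (by rw [hcard, H.finrank_eq])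
  rw [trace_eq_sum_automorphisms]
  have : ∑ s : F ≃ₐ[F₀] F, s z = ∑ s ∈ ({AlgEquiv.refl, H.σ} : Finset (F ≃ₐ[F₀] F)), s z := by
    rw [huniv]
  exact this.trans (by rw [Finset.sum_pair hne]; rfl)

theorem sigma_isIntegral {a : F} (ha : IsIntegral O₀ a) : IsIntegral O₀ (H.σ a) :=
  ha.map (H.σ.restrictScalars O₀ : F ≃ₐ[O₀] F)

theorem sigma_pi : H.σ H.pi = H.pi ∨ H.σ H.pi = -H.pi := by
  apply sq_eq_sq_iff_eq_or_eq_neg.1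
  rw [← map_pow, H.pi_sq, AlgEquiv.commutes]

theorem exists_of_isIntegral {z : F} (hz : IsIntegral O₀ (H.pi * z)) :
    ∃ c : O₀, algebraMap O₀ F₀ c = (2 : F₀)⁻¹ * Algebra.trace F₀ F z := by
  set c : F₀ := (2 : F₀)⁻¹ * Algebra.trace F₀ F z with hc
  have h2 := H.two_ne_zero'
  have h2F : algebraMap F₀ F 2 ≠ 0 := (map_ne_zero _).2 h2
  have hcF : algebraMap F₀ F 2 * algebraMap F₀ F c = z + H.σ z := by
    rw [← map_mul, hc, mul_inv_cancel_left₀ h2, H.trace_eq]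
  have hint2 : IsIntegral O₀ (H.pi * (z + H.σ z)) := by
    rw [mul_add]
    have h3 := H.sigma_isIntegral hz
    rw [map_mul] at h3
    rcases H.sigma_pi with h | h <;> rw [h] at h3
    · exact hz.add h3
    · exact hz.add (by simpa using h3.neg)
  have hint : IsIntegral O₀ (H.pi * algebraMap F₀ F c) := by
    obtain ⟨w, hw⟩ := H.isUnit_two
    have hw' : algebraMap O₀ F (↑w⁻¹ : O₀) * algebraMap F₀ F 2 = 1 := by
      have : algebraMap F₀ F 2 = algebraMap O₀ F (w : O₀) := by
        rw [hw, map_ofNat, map_ofNat]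
      rw [this, ← map_mul]
      simp
    have : H.pi * algebraMap F₀ F c
        = algebraMap O₀ F (↑w⁻¹ : O₀) * (H.pi * (z + H.σ z)) := by
      rw [← hcF]
      linear_combination (-(H.pi * algebraMap F₀ F c)) * hw'
    rw [this]
    exact isIntegral_algebraMap.mul hint2
  have hint3 : IsIntegral O₀ (algebraMap O₀ F₀ H.π₀ * c ^ 2) := by
    have h4 := hint.pow 2
    rw [mul_pow, H.pi_sq, ← map_pow, ← map_mul] at h4
    exact (isIntegral_algebraMap_iff (algebraMap F₀ F).injective).1 h4
  obtain ⟨b, hb⟩ := IsIntegrallyClosed.isIntegral_iff.1 hint3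
  rcases ValuationRing.isInteger_or_isInteger O₀ c with h | ⟨d, hd⟩
  · exact h
  by_cases hc0 : c = 0
  · exact ⟨0, by simp [hc0]⟩
  have hπ : H.π₀ = (b * d) * d := by
    apply IsFractionRing.injective O₀ F₀
    rw [map_mul, map_mul, hb, hd]
    field_simp
  have hdu : IsUnit d := by
    rcases H.irreducible_π₀.isUnit_or_isUnit hπ with h | h
    · exact isUnit_of_mul_isUnit_right h
    · exact h
  obtain ⟨w, rfl⟩ := hdu
  refine ⟨(↑w⁻¹ : O₀), ?_⟩
  have h5 : algebraMap O₀ F₀ (↑w⁻¹ : O₀) * algebraMap O₀ F₀ (w : O₀) = 1 := by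
    rw [← map_mul]; simp
  rw [hd] at h5
  field_simp at h5
  exact h5

theorem isIntegral_gen (i j : Fin (2 * m)) :
    IsIntegral O₀ (H.pi * H.φ (H.gen i) (H.gen j)) := by
  have hpi : IsIntegral O₀ H.pi :=
    (IsIntegralClosure.isIntegral O₀ F H.ϖ).map (IsScalarTower.toAlgHom O₀ OF F)
  have hφ : ∀ i j, H.φ (H.e i) (H.e j) = if i = j.rev then 1 else 0 := fun i j => by
    simpa using H.split i j.rev
  have h0 := H.pi_ne_zero
  by_cases hij : i = j.rev
  · have hv : (i : ℕ) + (j : ℕ) + 1 = 2 * m := by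
      rw [hij, Fin.val_rev]; omega
    unfold gen
    split_ifs with h1 h2 h2
    · omega
    · simp [hφ, hij, h0, isIntegral_one]
    · rcases H.sigma_pi with h | h <;> simp [hφ, hij, h0, h, isIntegral_one, isIntegral_one.neg]
    · simpa [hφ, hij] using hpi
  · unfold gen
    split_ifs <;> simp [hφ, hij, isIntegral_zero]

theorem isIntegral_lattice {x y : V} (hx : x ∈ H.latticeM) (hy : y ∈ H.latticeM) :
    IsIntegral O₀ (H.pi * H.φ x y) := by
  have hOF : ∀ a : OF, IsIntegral O₀ (algebraMap OF F a) := fun a =>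
    (IsIntegralClosure.isIntegral O₀ F a).map (IsScalarTower.toAlgHom O₀ OF F)
  induction hx using Submodule.span_induction with
  | zero => simp [isIntegral_zero]
  | add x x' _ _ h h' => simpa [mul_add] using h.add h'
  | smul a x _ h =>
    have : H.pi * H.φ (a • x) y = algebraMap OF F a * (H.pi * H.φ x y) := by
      rw [← algebraMap_smul F a x, map_smul, LinearMap.smul_apply, smul_eq_mul]; ring
    rw [this]; exact (hOF a).mul h
  | mem x hx =>
    obtain ⟨i, rfl⟩ := hx
    induction hy using Submodule.span_induction with
    | zero => simp [isIntegral_zero]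
    | add x x' _ _ h h' => simpa [mul_add] using h.add h'
    | smul a y _ h =>
      have : H.pi * H.φ (H.gen i) (a • y)
          = H.σ (algebraMap OF F a) * (H.pi * H.φ (H.gen i) y) := by
        rw [← algebraMap_smul F a y, LinearMap.map_smulₛₗ, smul_eq_mul, RingHom.coe_coe]; ring
      rw [this]; exact (H.sigma_isIntegral (hOF a)).mul h
    | mem y hy =>
      obtain ⟨j, rfl⟩ := hy
      exact H.isIntegral_gen i j

/-- The form `( , )` takes values in `O_{F₀}` on `Λ_m`. -/
theorem exists_symForm_eq (x y : H.latticeM) :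
    ∃ c : O₀, algebraMap O₀ F₀ c = H.symForm (x : V) (y : V) :=
  H.exists_of_isIntegral (H.isIntegral_lattice x.2 y.2)

/-- The value of `( , )` on two vectors of `Λ_m`, as an element of `O_{F₀}`. -/
def latticeVal (x y : H.latticeM) : O₀ := (H.exists_symForm_eq x y).choose

theorem algebraMap_latticeVal (x y : H.latticeM) :
    algebraMap O₀ F₀ (H.latticeVal x y) =
      (2 : F₀)⁻¹ * Algebra.trace F₀ F (H.φ (x : V) (y : V)) :=
  (H.exists_symForm_eq x y).choose_spec

theorem coe_smul_eq (c : O₀) (x : H.latticeM) :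
    ((c • x : H.latticeM) : V) = algebraMap F₀ F (algebraMap O₀ F₀ c) • (x : V) := by
  rw [Submodule.coe_smul_of_tower, ← IsScalarTower.algebraMap_apply,
    IsScalarTower.algebraMap_apply O₀ OF F, algebraMap_smul, algebraMap_smul]

theorem trace_mul (c : F₀) (z : F) :
    Algebra.trace F₀ F (algebraMap F₀ F c * z) = c * Algebra.trace F₀ F z := by
  rw [← Algebra.smul_def, map_smul, smul_eq_mul]

/-- The `O_{F₀}`-bilinear form `( , )` on `Λ_m`, with values in `O_{F₀}`. -/
def latticeForm : LinearMap.BilinForm O₀ H.latticeM :=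
  LinearMap.mk₂ O₀ H.latticeVal
    (fun x x' y => IsFractionRing.injective O₀ F₀ (by
      simp only [map_add, algebraMap_latticeVal, Submodule.coe_add, LinearMap.add_apply, mul_add]))
    (fun c x y => IsFractionRing.injective O₀ F₀ (by
      simp only [smul_eq_mul, map_mul, algebraMap_latticeVal, coe_smul_eq, map_smul,
        LinearMap.smul_apply, trace_mul]
      ring))
    (fun x y y' => IsFractionRing.injective O₀ F₀ (by
      simp only [map_add, algebraMap_latticeVal, Submodule.coe_add, mul_add]))
    (fun c x y => IsFractionRing.injective O₀ F₀ (by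
      simp only [smul_eq_mul, map_mul, algebraMap_latticeVal, coe_smul_eq, LinearMap.map_smulₛₗ,
        RingHom.coe_coe, AlgEquiv.commutes, trace_mul]
      ring))

theorem algebraMap_latticeForm (x y : H.latticeM) :
    algebraMap O₀ F₀ (H.latticeForm x y) = H.symForm (x : V) (y : V) :=
  H.algebraMap_latticeVal x y

end integrality
section moduli

variable (H : SplitHermitian O₀ F₀ OF F V m)

/-- `Λ_m ⊗_{O_{F₀}} O_F`, as a module over the second factor. -/
abbrev Lam : Type u := OF ⊗[O₀] H.latticeM

/-- The operator `t` on `Λ_m ⊗_{O_{F₀}} O_F`, i.e. multiplication by `π` on `Λ_m`. -/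
def t : H.Lam →ₗ[OF] H.Lam :=
  ((LinearMap.lsmul OF H.latticeM H.ϖ).restrictScalars O₀).baseChange OF

/-- The form `( , )`, extended linearly to `Λ_m ⊗_{O_{F₀}} O_F`. -/
def form : LinearMap.BilinForm OF H.Lam := H.latticeForm.baseChange OF

/-- `Λ_m ⊗_{O_{F₀}} R` for an `O_F`-algebra `R`, written as `R ⊗_{O_F} (O_F ⊗_{O_{F₀}} Λ_m)`. -/
abbrev LamR (R : Type u) [CommRing R] [Algebra OF R] : Type u := R ⊗[OF] H.Lam

/-- The submodule `Λ' ⊗ R` of `Λ_m ⊗ R`. -/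
def lambdaPrimeR (R : Type u) [CommRing R] [Algebra OF R] : Submodule R (H.LamR R) :=
  Submodule.span R {x | ∃ v ∈ H.lambdaPrime, x = (1 : R) ⊗ₜ[OF] ((1 : OF) ⊗ₜ[O₀] v)}

/-- A pair of submodules `(ℱ₀, ℱ₁)` of `Λ_m ⊗ R`. -/
@[ext]
structure Pair (R : Type u) [CommRing R] [Algebra OF R] where
  fil0 : Submodule R (H.LamR R)
  fil1 : Submodule R (H.LamR R)

variable {H}

/-- The base change of a pair along `f : R → R'`: the images of `ℱ₀ ⊗_R R'`, `ℱ₁ ⊗_R R'` in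
`Λ_m ⊗ R'`. -/
def Pair.map {R R' : Type u} [CommRing R] [Algebra OF R] [CommRing R'] [Algebra OF R']
    (f : R →ₐ[OF] R') (p : H.Pair R) : H.Pair R' where
  fil0 := Submodule.span R' (LinearMap.rTensor H.Lam f.toLinearMap '' (p.fil0 : Set (H.LamR R)))
  fil1 := Submodule.span R' (LinearMap.rTensor H.Lam f.toLinearMap '' (p.fil1 : Set (H.LamR R)))

/-- `N` is a direct summand of `P` of constant rank `k`. (Since a submodule of a finite free
module that is Zariski locally a direct summand is a direct summand, this is the condition of being
Zariski locally on `Spec R` a direct summand of rank `k`.) -/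
def IsSummandOfRank {R P : Type u} [CommRing R] [AddCommGroup P] [Module R P] (k : ℕ)
    (N : Submodule R P) : Prop :=
  (∃ N' : Submodule R P, IsCompl N N') ∧ ∀ 𝔭 : PrimeSpectrum R, Module.rankAtStalk (R := R) N 𝔭 = k

/-- The pair `(ℱ₀, ℱ₁)` is an `R`-valued point of the naive splitting model `ℳ` for the signature
`(2 * m - s, s)`. -/
structure Pair.IsPoint {R : Type u} [CommRing R] [Algebra OF R] (s : ℕ) (p : H.Pair R) : Prop where
  rank0 : IsSummandOfRank s p.fil0
  rank1 : IsSummandOfRank (2 * m) p.fil1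
  le : p.fil0 ≤ p.fil1
  perp : p.fil1 = (H.form.baseChange R).orthogonal p.fil1
  add_mem : ∀ x ∈ p.fil1, H.t.baseChange R x + algebraMap OF R H.ϖ • x ∈ p.fil0
  sub_eq_zero : ∀ x ∈ p.fil0, H.t.baseChange R x - algebraMap OF R H.ϖ • x = 0

/-- `p` is the pullback of `u`, i.e. it lies in the image of the map of functors
`Spec B → ℳ` given by `u`. -/
def Pair.InChart {B : Type u} [CommRing B] [Algebra OF B] (u : H.Pair B)
    {R : Type u} [CommRing R] [Algebra OF R] (p : H.Pair R) : Prop :=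
  ∃ g : B →ₐ[OF] R, p = u.map g

/-- The point `u ∈ ℳ(B)` defines an open immersion of functors `Spec B → ℳ`: this map is injective,
and its image is an open subfunctor, i.e. for each `p ∈ ℳ(R)` there is an ideal `I` of `R` such that
the pullback of `p` along `R → R'` lies in the image if and only if `Spec R' → Spec R` factors
through the open subset `Spec R ∖ V(I)`. -/
structure Pair.IsOpenChart {B : Type u} [CommRing B] [Algebra OF B] (s : ℕ) (u : H.Pair B) :
    Prop where
  isPoint : u.IsPoint s
  injective : ∀ (R : Type u) [CommRing R] [Algebra OF R],
    Function.Injective (fun g : B →ₐ[OF] R => u.map g)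
  isOpen : ∀ (R : Type u) [CommRing R] [Algebra OF R] (p : H.Pair R), p.IsPoint s →
    ∃ I : Ideal R, ∀ (R' : Type u) [CommRing R'] [Algebra OF R'] (f : R →ₐ[OF] R'),
      u.InChart (p.map f) ↔ I.map f = ⊤

variable (H) in
/-- The `O_F`-scheme `X` represents the functor `ℳ`: for `O_F`-algebras `R`, its `R`-valued points
are identified with the pairs `(ℱ₀, ℱ₁) ∈ ℳ(R)`, compatibly with base change. -/
structure Represents (s : ℕ) (X : Over (Spec (CommRingCat.of OF))) where
  equiv : ∀ (R : Type u) [CommRing R] [Algebra OF R],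
    {g : Spec (CommRingCat.of R) ⟶ X.left //
      g ≫ X.hom = Spec.map (CommRingCat.ofHom (algebraMap OF R))} ≃
    {p : H.Pair R // p.IsPoint s}
  natural : ∀ (R R' : Type u) [CommRing R] [Algebra OF R] [CommRing R'] [Algebra OF R']
    (f : R →ₐ[OF] R') (g : {g : Spec (CommRingCat.of R) ⟶ X.left //
      g ≫ X.hom = Spec.map (CommRingCat.ofHom (algebraMap OF R))})
    (g' : {g : Spec (CommRingCat.of R') ⟶ X.left //
      g ≫ X.hom = Spec.map (CommRingCat.ofHom (algebraMap OF R'))}),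
    g'.1 = Spec.map (CommRingCat.ofHom f.toRingHom) ≫ g.1 →
    (equiv R' g').1 = (equiv R g).1.map f

end moduli

end SplitHermitian

/-! ### The equations of the chart -/

namespace ChartEquations

variable (A : Type u) [CommRing A] (h d : ℕ)

/-- The variables: the entries of `D` (size `d × d`) and of `M₂` (size `2h × (d + 1)`). -/
abbrev Vars : Type := (Fin d × Fin d) ⊕ (Fin (2 * h) × Fin (d + 1))

/-- The generic matrix `D`. -/
def matD : Matrix (Fin d) (Fin d) (MvPolynomial (Vars h d) A) :=
  Matrix.of fun p q => MvPolynomial.X (Sum.inl (p, q))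

/-- The generic matrix `M₂ = (a_{k,j})`. -/
def matM : Matrix (Fin (2 * h)) (Fin (d + 1)) (MvPolynomial (Vars h d) A) :=
  Matrix.of fun k j => MvPolynomial.X (Sum.inr (k, j))

/-- The matrix `Q`, built from all columns of `M₂` but the first:
`q_{i,j} = ∑_{k=1}^{h} (a_{k,i} a_{2h+1-k,j} - a_{2h+1-k,i} a_{k,j})`. -/
def matQ : Matrix (Fin d) (Fin d) (MvPolynomial (Vars h d) A) :=
  Matrix.of fun i j => ∑ k : Fin h,
    let k' : Fin (2 * h) := Fin.castLE (by omega) k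
    (matM A h d k' i.succ * matM A h d k'.rev j.succ
      - matM A h d k'.rev i.succ * matM A h d k' j.succ)

/-- The matrix `[0 | I_d]` of size `d × (d + 1)`. -/
def zeroOne : Matrix (Fin d) (Fin (d + 1)) (MvPolynomial (Vars h d) A) :=
  Matrix.of fun p j => if j = p.succ then 1 else 0

/-- The ideal generated by the entries of `M₂' - [0 | I_d]`, `D + Dᵗ` and `D Q + 2 ϖ I_d`, where
`M₂'` consists of the rows of `M₂` with indices `rows 0, …, rows (d - 1)`. -/
def ideal (ϖ : A) (rows : Fin d ↪ Fin (2 * h)) : Ideal (MvPolynomial (Vars h d) A) :=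
  Ideal.span
    (Set.range (fun x : Fin d × Fin (d + 1) =>
        ((matM A h d).submatrix rows id - zeroOne A h d) x.1 x.2) ∪
     Set.range (fun x : Fin d × Fin d => (matD A h d + (matD A h d).transpose) x.1 x.2) ∪
     Set.range (fun x : Fin d × Fin d =>
        (matD A h d * matQ A h d + (2 * MvPolynomial.C ϖ : MvPolynomial (Vars h d) A) •
          (1 : Matrix (Fin d) (Fin d) (MvPolynomial (Vars h d) A))) x.1 x.2))

/-- The ring `A[D, M₂] / I`. -/
abbrev Ring (ϖ : A) (rows : Fin d ↪ Fin (2 * h)) : Type u :=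
  MvPolynomial (Vars h d) A ⧸ ideal A h d ϖ rows

end ChartEquations
end

/-!
Let `f_i` be the generators of `Λ_m`. Over an `O_F`-algebra `R` the vectors `f_i` and `h_i = (t +
π) f_i` form a basis of `Λ_m ⊗ R`. In the coordinates `(a, c)` for this basis, `(t + π)(a, c) =
(0, a + 2πc)`, the kernel of `t - π` is spanned by the `h_i`, and the symmetric form becomes `ω(a,
c') + ω(a', c)` with a perfect alternating form `ω`. So `ℱ₀` is a submodule of the span of the
`h_i`, and the conditions on `(ℱ₀, ℱ₁)` are those of `ChartCoord.IsFlag`, apart from the ranks and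
the maximality of the isotropic `ℱ₁`.

The chart of `i_2, …, i_s` consists of the pairs for which the coordinates of the `h_i` with `i =
1` and with the `s - 1` chosen middle indices are coordinates on `ℱ₀` (`proj0`), and for which the
coordinates that are free on `Λ'` modulo `π` are coordinates on `ℱ₁` (`proj1`). On the chart, `ℱ₀`
has a unique basis `X_0, …, X_q`, `q = s - 1`, dual to the chosen coordinates. Its middle
coordinates form the matrix `M₂`. For `x = (a, c) ∈ ℱ₁` write `(t + π) x = ∑ ψ_j X_j` and `y_j =
ω(X_j, c)`. Isotropy of `ℱ₁` reads `∑ (ψ_j(x) y_j(x') + ψ_j(x') y_j(x)) = 0`, and on the chart the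
functions `ψ_0, y_1, …, y_q` take all values on `ℱ₁`. Hence `(y_0, ψ_1, …, ψ_q)` is obtained from
`(ψ_0, y_1, …, y_q)` by a skew matrix, which consists of a vector `d` and the skew matrix `D`, and
which determines `ℱ₁`. The orthogonality of `ℱ₀ ⊆ ℱ₁` and `ℱ₁` then says that `D Q + 2π = 0` and
that the last coordinates of `X_1, …, X_q` are determined by `d` and `M₂`, while the last
coordinate `w` of `X_0` is free. Conversely such data define a point of the chart. So the chart is
represented by `A[w, d] ⊗ A[D, M₂] / I`, `A = O_F`, which is the product of an affine space of
dimension `s` and the given scheme. The two directions are `exists_data` and `Data.Valid.isFlag`,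
the uniqueness is `Data.Valid.ext`, and `Data.valid_iff` compares the equations with the ideal
`I`.

The chart is open since the surjectivity of a linear map from a submodule to a free module of rank
`k` is equivalent to the ideal of its `k × k` determinants being the unit ideal, compatibly with
base change (`map_span_eq_top_iff`). For the points `(ℱ₀, Λ')` over a field, `(t + π) Λ' ⊆ ℱ₀` and
`s < n - 1` force `π = 0`, and then `h_1 ∈ ℱ₀` while the last coordinate vanishes on `ℱ₀`, so that
some choice of middle coordinates completes the first one to a system of coordinates on `ℱ₀`.

Finally, an open chart in the sense of functors gives a monomorphism from the spectrum of its ring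
to a representing scheme `X`, which has sections locally around its image. The sections glue, so
that it is an isomorphism onto an affine open subscheme (`Represents.exists_isAffineOpen`).
-/

noncomputable section

/-! ### Coordinates and the data of a chart -/

namespace ChartCoord

/-- The index set `{1, …, 2h + 2}` of a half basis: `none` is the first index, `some none` the
last one, and `some (some k)` are the `2h` indices in between. -/
abbrev Idx (h : ℕ) : Type := Option (Option (Fin (2 * h)))

/-- Coordinates on `Λ_m ⊗ R` for the basis consisting of the `f_i` (first component) and of the
`(t + π) f_i` (second component), where `f_i` runs through the generators of `Λ_m`. -/
abbrev Coord (h : ℕ) (R : Type*) : Type _ := (Idx h → R) × (Idx h → R)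

section forms

variable {h : ℕ} (R : Type*) [CommRing R]

/-- The sign `ε_k` by which the `k`-th middle basis vector pairs with the opposite one. -/
def sgn (k : Fin (2 * h)) : R := if (k : ℕ) < h then -1 else 1

variable {R}

theorem sgn_rev (k : Fin (2 * h)) : sgn R k.rev = -sgn R k := by
  unfold sgn
  have := k.isLt
  rw [Fin.val_rev]
  split_ifs <;> first | omega | simp

theorem sgn_mul_self (k : Fin (2 * h)) : sgn R k * sgn R k = 1 := by
  unfold sgn
  split_ifs <;> simp

/-- The alternating form on the middle coordinates. -/
def midForm : LinearMap.BilinForm R (Fin (2 * h) → R) :=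
  LinearMap.mk₂ R (fun x y => ∑ k, sgn R k * x k * y k.rev)
    (fun x x' y => by simp only [Pi.add_apply, mul_add, add_mul, Finset.sum_add_distrib])
    (fun c x y => by
      simp only [Pi.smul_apply, smul_eq_mul, Finset.mul_sum]
      exact Finset.sum_congr rfl fun _ _ => by ring)
    (fun x y y' => by simp only [Pi.add_apply, mul_add, Finset.sum_add_distrib])
    (fun c x y => by
      simp only [Pi.smul_apply, smul_eq_mul, Finset.mul_sum]
      exact Finset.sum_congr rfl fun _ _ => by ring)

theorem midForm_apply (x y : Fin (2 * h) → R) :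
    midForm x y = ∑ k, sgn R k * x k * y k.rev := rfl

theorem midForm_neg (x y : Fin (2 * h) → R) : midForm y x = -midForm x y := by
  rw [midForm_apply, midForm_apply, ← Equiv.sum_comp Fin.revPerm, ← Finset.sum_neg_distrib]
  refine Finset.sum_congr rfl fun k _ => ?_
  simp only [Fin.revPerm_apply, Fin.rev_rev, sgn_rev]
  ring

theorem midForm_eq_sum_half (x y : Fin (2 * h) → R) :
    midForm x y = -∑ k : Fin h, (x (Fin.castLE (by omega) k) * y (Fin.castLE (by omega) k).rev
      - x (Fin.castLE (by omega) k).rev * y (Fin.castLE (by omega) k)) := by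
  have e : h + h = 2 * h := by omega
  rw [midForm_apply, ← Equiv.sum_comp (finCongr e), Fin.sum_univ_add,
    ← Equiv.sum_comp Fin.revPerm (fun i : Fin h => sgn R (finCongr e (Fin.natAdd h i)) * _ * _),
    ← Finset.sum_add_distrib, ← Finset.sum_neg_distrib]
  refine Finset.sum_congr rfl fun k _ => ?_
  have h1 : finCongr e (Fin.castAdd h k) = Fin.castLE (by omega) k := by ext; simp
  have h2 : finCongr e (Fin.natAdd h (Fin.revPerm k)) =
      (Fin.castLE (by omega) k : Fin (2 * h)).rev := by
    ext
    simp only [Fin.revPerm_apply, finCongr_apply, Fin.val_cast, Fin.val_natAdd, Fin.val_rev,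
      Fin.val_castLE]
    omega
  rw [h1, h2, sgn_rev, Fin.rev_rev]
  have h3 : sgn R (Fin.castLE (by omega) k : Fin (2 * h)) = -1 := by simp [sgn]
  rw [h3]
  ring

/-- The alternating form `ω` on half of the coordinates: the form `( , )` pairs the `f_i` and the
`(t + π) f_i` through `ω`. -/
def sp : LinearMap.BilinForm R (Idx h → R) :=
  LinearMap.mk₂ R (fun a c => -(a none * c (some none)) + a (some none) * c none +
      midForm (fun k => a (some (some k))) (fun k => c (some (some k))))
    (fun x x' y => by
      have : (fun k => (x + x') (some (some k))) = (fun k => x (some (some k))) +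
        (fun k => x' (some (some k))) := rfl
      rw [this, map_add]
      simp only [Pi.add_apply, LinearMap.add_apply]; ring)
    (fun r x y => by
      have : (fun k => (r • x) (some (some k))) = r • (fun k => x (some (some k))) := rfl
      rw [this, map_smul]
      simp only [Pi.smul_apply, LinearMap.smul_apply, smul_eq_mul]; ring)
    (fun x y y' => by
      have : (fun k => (y + y') (some (some k))) = (fun k => y (some (some k))) +
        (fun k => y' (some (some k))) := rfl
      rw [this, map_add]
      simp only [Pi.add_apply]; ring)
    (fun r x y => by
      have : (fun k => (r • y) (some (some k))) = r • (fun k => y (some (some k))) := rfl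
      rw [this, map_smul]
      simp only [Pi.smul_apply, smul_eq_mul]; ring)

theorem sp_apply (a c : Idx h → R) : sp a c = -(a none * c (some none)) + a (some none) * c none +
      midForm (fun k => a (some (some k))) (fun k => c (some (some k))) := rfl

theorem sp_neg (a c : Idx h → R) : sp c a = -sp a c := by
  rw [sp_apply, sp_apply, midForm_neg]; ring

/-- The symmetric form `( , )` in coordinates. -/
def bil (x y : Coord h R) : R := sp x.1 y.2 + sp y.1 x.2

/-- The form `ω` is nondegenerate. -/
theorem eq_zero_of_sp_eq_zero (a : Idx h → R) (ha : ∀ c, sp a c = 0) : a = 0 := by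
  funext i
  match i with
  | none =>
    have := ha (Pi.single (some none) 1)
    simpa [sp_apply, midForm_apply] using this
  | some none =>
    have := ha (Pi.single none 1)
    simpa [sp_apply, midForm_apply] using this
  | some (some k) =>
    have := ha (Pi.single (some (some k.rev)) 1)
    simp only [sp_apply, midForm_apply] at this
    rw [Finset.sum_eq_single k] at this
    · have h1 := congrArg (sgn R k * ·) this
      simpa [← mul_assoc, sgn_mul_self] using h1
    · intro l _ hl
      rw [Pi.single_eq_of_ne]
      · simp
      · simpa using hl
    · simp

end forms

/-- The data of a chart: the free coordinates `w` and `d`, and the matrices `D` and `M₂`. -/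
@[ext]
structure Data (h q : ℕ) (R : Type*) where
  w : R
  d : Fin q → R
  D : Matrix (Fin q) (Fin q) R
  M : Matrix (Fin (2 * h)) (Fin (q + 1)) R

namespace Data

variable {h q : ℕ} {R : Type*} [CommRing R]

/-- The alternating products of the columns of `M₂`. Without the first row and column this is the
matrix `-Q`. -/
def omega (z : Data h q R) (i j : Fin (q + 1)) : R := midForm (fun k => z.M k i) (fun k => z.M k j)

/-- The last coordinates of the generators of `ℱ₀`; all but the first of them are determined by
the rest of the data, because `ℱ₁` is contained in the orthogonal complement of `ℱ₀`. -/
def last (z : Data h q R) : Fin (q + 1) → R :=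
  Fin.cons z.w fun j => ∑ k, z.omega j.succ k.succ * z.d k - z.omega j.succ 0

/-- The generators of `ℱ₀`, in terms of the vectors `(t + π) f_i`. -/
def col (z : Data h q R) (j : Fin (q + 1)) : Idx h → R
  | none => if j = 0 then 1 else 0
  | some none => z.last j
  | some (some k) => z.M k j

/-- The equations between the coordinates of a chart. -/
structure Valid (ϖ : R) (rows : Fin q ↪ Fin (2 * h)) (z : Data h q R) : Prop where
  M_rows : ∀ p j, z.M (rows p) j = if j = p.succ then 1 else 0
  D_skew : ∀ p p', z.D p' p = -z.D p p'
  D_omega : ∀ p p', ∑ k, z.D p k * z.omega k.succ p'.succ = if p = p' then 2 * ϖ else 0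

/-- The linear combinations of the generators of `ℱ₀`. -/
def comb (z : Data h q R) : (Fin (q + 1) → R) →ₗ[R] (Idx h → R) := Fintype.linearCombination R z.col

theorem comb_apply (z : Data h q R) (v : Fin (q + 1) → R) : z.comb v = ∑ j, v j • z.col j := by
  simp [comb, Fintype.linearCombination_apply]

/-- The submodule `ℱ₀` of a chart. -/
def fil0 (z : Data h q R) : Submodule R (Coord h R) :=
  (LinearMap.range z.comb).map (LinearMap.inr R _ _)

theorem mem_fil0 {z : Data h q R} {x : Coord h R} : x ∈ z.fil0 ↔ ∃ v, x = (0, z.comb v) := by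
  simp [fil0, Prod.ext_iff, eq_comm]

/-- The submodule `ℱ₁` of a chart. An element `(a, c)` is sent by `t + π` to the combination with
coefficients `ψ` of the generators `X_j` of `ℱ₀`, and as `ℱ₁` is isotropic, the vectors
`(ω(X_0, c), ψ_1, …, ψ_q)` and `(ψ_0, ω(X_1, c), …, ω(X_q, c))` are related by a skew matrix. -/
def fil1 (ϖ : R) (z : Data h q R) : Submodule R (Coord h R) where
  carrier := {x | ∃ ψ, x.1 + (2 * ϖ) • x.2 = z.comb ψ ∧
    sp (z.col 0) x.2 = ∑ k, z.d k * sp (z.col k.succ) x.2 ∧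
    ∀ k : Fin q, ψ k.succ = -(z.d k * ψ 0) + ∑ l, z.D k l * sp (z.col l.succ) x.2}
  zero_mem' := ⟨0, by simp, by simp, by simp⟩
  add_mem' := by
    rintro x y ⟨ψ, h1, h2, h3⟩ ⟨χ, h4, h5, h6⟩
    refine ⟨ψ + χ, ?_, ?_, fun k => ?_⟩
    · rw [map_add, ← h1, ← h4, Prod.fst_add, Prod.snd_add, smul_add]; abel
    · simp only [Prod.snd_add, map_add, mul_add, Finset.sum_add_distrib, h2, h5]
    · simp only [Prod.snd_add, map_add, mul_add, Finset.sum_add_distrib, h3, h6, Pi.add_apply]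
      ring
  smul_mem' := by
    rintro r x ⟨ψ, h1, h2, h3⟩
    refine ⟨r • ψ, ?_, ?_, fun k => ?_⟩
    · rw [map_smul, ← h1, Prod.smul_fst, Prod.smul_snd, smul_add, smul_comm r]
    · simp only [Prod.smul_snd, map_smul, smul_eq_mul, h2, Finset.mul_sum]
      exact Finset.sum_congr rfl fun _ _ => by ring
    · simp only [Prod.smul_snd, map_smul, smul_eq_mul, h3, Finset.mul_sum, Pi.smul_apply, mul_add]
      congr 1
      · ring
      · exact Finset.sum_congr rfl fun _ _ => by ring

theorem mem_fil1 {ϖ : R} {z : Data h q R} {x : Coord h R} : x ∈ z.fil1 ϖ ↔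
    ∃ ψ, x.1 + (2 * ϖ) • x.2 = z.comb ψ ∧
      sp (z.col 0) x.2 = ∑ k, z.d k * sp (z.col k.succ) x.2 ∧
      ∀ k : Fin q, ψ k.succ = -(z.d k * ψ 0) + ∑ l, z.D k l * sp (z.col l.succ) x.2 := Iff.rfl

end Data

section projections

variable {h q : ℕ} (R : Type*) [CommRing R]

/-- The indices of the rows in which the generators of `ℱ₀` form an identity matrix. -/
def piv (rows : Fin q ↪ Fin (2 * h)) : Fin (q + 1) → Idx h :=
  Fin.cons none fun p => some (some (rows p))

@[simp] theorem piv_zero (rows : Fin q ↪ Fin (2 * h)) : piv rows 0 = none := rfl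
@[simp] theorem piv_succ (rows : Fin q ↪ Fin (2 * h)) (p : Fin q) :
    piv rows p.succ = some (some (rows p)) := rfl

/-- The coordinates that parametrize `ℱ₀` in a chart. -/
def proj0 (rows : Fin q ↪ Fin (2 * h)) : Coord h R →ₗ[R] (Fin (q + 1) → R) :=
  LinearMap.funLeft R R (piv rows) ∘ₗ LinearMap.snd R _ _

/-- The coordinates that parametrize `ℱ₁` in a chart: those that do not vanish on `Λ'` at `π = 0`.
The value at the last index is the first coordinate for the `f_i`. -/
def proj1 : Coord h R →ₗ[R] (Idx h → R) :=
  LinearMap.pi fun i => match i with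
    | none => LinearMap.proj none ∘ₗ LinearMap.snd R _ _
    | some none => LinearMap.proj none ∘ₗ LinearMap.fst R _ _
    | some (some k) => LinearMap.proj (some (some k)) ∘ₗ LinearMap.snd R _ _

variable {R}

@[simp] theorem proj0_apply (rows : Fin q ↪ Fin (2 * h)) (x : Coord h R) (j) :
    proj0 R rows x j = x.2 (piv rows j) := rfl
@[simp] theorem proj1_none (x : Coord h R) : proj1 R x none = x.2 none := rfl
@[simp] theorem proj1_some_none (x : Coord h R) : proj1 R x (some none) = x.1 none := rfl
@[simp] theorem proj1_some_some (x : Coord h R) (k) :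
    proj1 R x (some (some k)) = x.2 (some (some k)) := rfl

/-- Vectors of `ker proj1` are orthogonal to each other. -/
theorem bil_of_proj1_eq_zero {x y : Coord h R} (hx : proj1 R x = 0) (hy : proj1 R y = 0) :
    bil x y = 0 := by
  have e (i) : proj1 R x i = 0 := by rw [hx]; rfl
  have e' (i) : proj1 R y i = 0 := by rw [hy]; rfl
  have h1 := e none
  have h2 := e (some none)
  have h3 := e' none
  have h4 := e' (some none)
  have h5 : ∀ k, x.2 (some (some k)) = 0 := fun k => e (some (some k))
  have h6 : ∀ k, y.2 (some (some k)) = 0 := fun k => e' (some (some k))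
  rw [proj1_none] at h1 h3
  rw [proj1_some_none] at h2 h4
  simp [bil, sp_apply, midForm_apply, h1, h2, h3, h4, h5, h6]

theorem bil_add_right (x y z : Coord h R) : bil x (y + z) = bil x y + bil x z := by
  simp only [bil, Prod.fst_add, Prod.snd_add, map_add, LinearMap.add_apply]; ring

theorem bil_comm (x y : Coord h R) : bil x y = bil y x := add_comm _ _

/-- If `N` is isotropic and surjects along `proj1`, then a vector orthogonal to `N` is determined
by its image under `proj1`: a vector in the kernel is orthogonal to everything. -/
theorem eq_zero_of_proj1_eq_zero {N : Submodule R (Coord h R)} (hN : N.map (proj1 R) = ⊤)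
    {x : Coord h R} (hx : ∀ y ∈ N, bil x y = 0) (h0 : proj1 R x = 0) : x = 0 := by
  have key : ∀ y, bil x y = 0 := by
    intro y
    obtain ⟨n, hn, hny⟩ : proj1 R y ∈ N.map (proj1 R) := by rw [hN]; trivial
    have : y = n + (y - n) := by abel
    rw [this, bil_add_right, hx n hn, bil_of_proj1_eq_zero h0 (by rw [map_sub, hny, sub_self]),
      add_zero]
  refine Prod.ext (eq_zero_of_sp_eq_zero _ fun c => ?_) (eq_zero_of_sp_eq_zero _ fun a => ?_)
  · simpa [bil] using key (0, c)
  · have := key (a, 0)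
    rw [sp_neg]
    simpa [bil] using this

theorem eq_of_le_of_map_eq_top {P Q : Type*} [AddCommGroup P] [Module R P] [AddCommGroup Q]
    [Module R Q] (g : P →ₗ[R] Q) {N N' : Submodule R P} (hle : N ≤ N') (hN : N.map g = ⊤)
    (hinj : ∀ x ∈ N', g x = 0 → x = 0) : N = N' := by
  refine le_antisymm hle fun x hx => ?_
  obtain ⟨n, hn, hnx⟩ : g x ∈ N.map g := by rw [hN]; trivial
  have : x - n = 0 := hinj _ (N'.sub_mem hx (hle hn)) (by rw [map_sub, hnx, sub_self])
  rwa [sub_eq_zero.1 this]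

end projections

end ChartCoord

/-! ### The flags of a chart -/

namespace ChartCoord

variable {h q : ℕ} {R : Type*} [CommRing R]

theorem sp_self (h2 : IsUnit (2 : R)) (a : Idx h → R) : sp a a = 0 := by
  have := sp_neg a a
  rw [eq_neg_iff_add_eq_zero, ← two_mul] at this
  exact h2.mul_right_eq_zero.1 this

theorem midForm_dual (rows : Fin q ↪ Fin (2 * h)) (k : Fin q) (x : Fin (2 * h) → R) :
    midForm x (Pi.single (rows k).rev (sgn R (rows k))) = x (rows k) := by
  rw [midForm_apply, Finset.sum_eq_single (rows k)]
  · rw [Pi.single_eq_same, mul_right_comm, sgn_mul_self, one_mul]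
  · intro l _ hl
    rw [Pi.single_eq_of_ne, mul_zero]
    simpa using hl
  · simp

namespace Data

variable {ϖ : R} {rows : Fin q ↪ Fin (2 * h)} {z : Data h q R}

@[simp] theorem col_zero_none : z.col 0 none = 1 := rfl
@[simp] theorem col_succ_none (j : Fin q) : z.col j.succ none = 0 := rfl
@[simp] theorem col_zero_last : z.col 0 (some none) = z.w := rfl
@[simp] theorem col_succ_last (j : Fin q) : z.col j.succ (some none) =
  ∑ k, z.omega j.succ k.succ * z.d k - z.omega j.succ 0 := rfl
@[simp] theorem col_mid (j : Fin (q + 1)) (k) : z.col j (some (some k)) = z.M k j := rfl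

theorem sp_col_zero (c : Idx h → R) : sp (z.col 0) c =
    -c (some none) + z.w * c none + midForm (fun k => z.M k 0) (fun k => c (some (some k))) := by
  simp [sp_apply]

theorem sp_col_succ (j : Fin q) (c : Idx h → R) : sp (z.col j.succ) c = z.col j.succ (some none) *
    c none + midForm (fun k => z.M k j.succ) (fun k => c (some (some k))) := by
  simp [sp_apply]

theorem sp_col_succ_succ (j k : Fin q) :
    sp (z.col j.succ) (z.col k.succ) = z.omega j.succ k.succ := by
  rw [sp_col_succ]; simp [omega]

theorem sp_col_succ_zero (j : Fin q) :
    sp (z.col j.succ) (z.col 0) = ∑ k, z.omega j.succ k.succ * z.d k := by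
  rw [sp_col_succ]; simp [omega]

theorem sp_comb (v : Fin (q + 1) → R) (c : Idx h → R) :
    sp (z.comb v) c = ∑ j, v j * sp (z.col j) c := by
  simp [comb_apply, map_sum, LinearMap.sum_apply]

theorem sp_comb_right (v : Fin (q + 1) → R) (c : Idx h → R) :
    sp c (z.comb v) = ∑ j, v j * sp c (z.col j) := by
  simp [comb_apply, map_sum]

theorem Valid.col_piv (hz : z.Valid ϖ rows) (i j : Fin (q + 1)) :
    z.col j (piv rows i) = if i = j then 1 else 0 := by
  refine Fin.cases ?_ (fun p => ?_) i
  · simp [col, eq_comm]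
  · simp [hz.M_rows, eq_comm]

theorem Valid.comb_piv (hz : z.Valid ϖ rows) (v : Fin (q + 1) → R) (i : Fin (q + 1)) :
    z.comb v (piv rows i) = v i := by
  simp [comb_apply, Finset.sum_apply, hz.col_piv]

theorem Valid.map_proj0_fil0 (hz : z.Valid ϖ rows) : z.fil0.map (proj0 R rows) = ⊤ := by
  refine eq_top_iff.2 fun v _ => ⟨(0, z.comb v), mem_fil0.2 ⟨v, rfl⟩, ?_⟩
  funext j
  exact hz.comb_piv v j

theorem Valid.eq_zero_of_proj0 (hz : z.Valid ϖ rows) {x : Coord h R} (hx : x ∈ z.fil0)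
    (h0 : proj0 R rows x = 0) : x = 0 := by
  obtain ⟨v, rfl⟩ := mem_fil0.1 hx
  have : v = 0 := by
    funext j
    rw [← hz.comb_piv v j]
    exact congrFun h0 j
  rw [this, map_zero]; rfl

theorem Valid.map_proj1_fil1 (hz : z.Valid ϖ rows) : (z.fil1 ϖ).map (proj1 R) = ⊤ := by
  refine eq_top_iff.2 fun v _ => ?_
  -- the last coordinate `c (some none)` is the solution of the equation for `ω(X_0, c)`
  let y : Fin q → R := fun j => z.col j.succ (some none) * v none +
    midForm (fun k => z.M k j.succ) (fun k => v (some (some k)))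
  let c : Idx h → R := Function.update v (some none)
    (z.w * v none + midForm (fun k => z.M k 0) (fun k => v (some (some k))) - ∑ k, z.d k * y k)
  have hy : ∀ j, sp (z.col j.succ) c = y j := fun j => by
    rw [sp_col_succ]; simp [c, y]
  let ψ : Fin (q + 1) → R := Fin.cons (v (some none) + 2 * ϖ * v none)
    fun k => -(z.d k * (v (some none) + 2 * ϖ * v none)) + ∑ l, z.D k l * y l
  refine ⟨(z.comb ψ - (2 * ϖ) • c, c), mem_fil1.2 ⟨ψ, ?_, ?_, fun k => ?_⟩, ?_⟩
  · simp
  · simp only [hy]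
    rw [sp_col_zero]
    simp only [c, Function.update_self, ne_eq, reduceCtorEq, not_false_eq_true,
      Function.update_of_ne, Option.some.injEq]
    ring
  · simp [hy, ψ]
  · funext i
    match i with
    | none => simp [c]
    | some none =>
      have := hz.comb_piv ψ 0
      rw [piv_zero] at this
      simp [this, ψ, c]
    | some (some k) => simp [c]

theorem Valid.bil_eq_zero (hz : z.Valid ϖ rows) {x y : Coord h R} (hx : x ∈ z.fil1 ϖ)
    (hy : y ∈ z.fil1 ϖ) : bil x y = 0 := by
  obtain ⟨ψ, h1, h2, h3⟩ := mem_fil1.1 hx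
  obtain ⟨χ, h4, h5, h6⟩ := mem_fil1.1 hy
  have e1 : x.1 = z.comb ψ - (2 * ϖ) • x.2 := by rw [← h1]; abel
  have e2 : y.1 = z.comb χ - (2 * ϖ) • y.2 := by rw [← h4]; abel
  have e3 : sp y.2 x.2 = - sp x.2 y.2 := sp_neg _ _
  rw [bil, e1, e2]
  simp only [map_sub, map_smul, LinearMap.sub_apply, LinearMap.smul_apply, sp_comb,
    Fin.sum_univ_succ, smul_eq_mul, e3, h2, h5, h3, h6, add_mul, Finset.sum_add_distrib,
    Finset.mul_sum, Finset.sum_mul]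
  have e4 : ∑ k, ∑ l, z.D k l * sp (z.col l.succ) x.2 * sp (z.col k.succ) y.2 =
      -∑ k, ∑ l, z.D k l * sp (z.col l.succ) y.2 * sp (z.col k.succ) x.2 := by
    rw [Finset.sum_comm, ← Finset.sum_neg_distrib]
    refine Finset.sum_congr rfl fun k _ => ?_
    rw [← Finset.sum_neg_distrib]
    refine Finset.sum_congr rfl fun l _ => ?_
    rw [hz.D_skew]; ring
  rw [e4]
  have e5 (a : R) (b : Fin q → R) : ∑ k, a * (z.d k * b k) = -∑ k, -(z.d k * a) * b k := by
    rw [← Finset.sum_neg_distrib]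
    exact Finset.sum_congr rfl fun l _ => by ring
  rw [e5, e5]
  ring

/-- `ℱ₁` is its own orthogonal complement. -/
theorem Valid.mem_fil1_of_bil (hz : z.Valid ϖ rows) {x : Coord h R}
    (hx : ∀ y ∈ z.fil1 ϖ, bil x y = 0) : x ∈ z.fil1 ϖ := by
  obtain ⟨n, hn, hnx⟩ : proj1 R x ∈ (z.fil1 ϖ).map (proj1 R) := by
    rw [hz.map_proj1_fil1]; trivial
  have : n - x = 0 := by
    refine eq_zero_of_proj1_eq_zero hz.map_proj1_fil1 (fun y hy => ?_)
      (by rw [map_sub, hnx, sub_self])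
    have e : n = (n - x) + x := by abel
    have h1 := hz.bil_eq_zero hn hy
    rw [bil_comm] at h1 ⊢
    rw [e, bil_add_right, bil_comm y x, hx y hy, add_zero] at h1
    exact h1
  rwa [← sub_eq_zero.1 this]

/-- The defining formula for `last` and the equation for `D Q` are what is needed for `ℱ₀ ⊆ ℱ₁`. -/
theorem Valid.fil0_le_fil1 (h2 : IsUnit (2 : R)) (hz : z.Valid ϖ rows) : z.fil0 ≤ z.fil1 ϖ := by
  intro x hx
  obtain ⟨v, rfl⟩ := mem_fil0.1 hx
  have hs (j : Fin q) : sp (z.col j.succ) (z.comb v) =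
      ∑ k, z.omega j.succ k.succ * (z.d k * v 0 + v k.succ) := by
    rw [sp_comb_right, Fin.sum_univ_succ, sp_col_succ_zero, Finset.mul_sum,
      ← Finset.sum_add_distrib]
    refine Finset.sum_congr rfl fun k _ => ?_
    rw [sp_col_succ_succ]; ring
  -- `∑ d_k ω(X_k, X_l) d_l` vanishes, since the form is alternating
  have h0 : ∑ k, z.d k * ∑ l, z.omega k.succ l.succ * z.d l = 0 := by
    have e : ∑ k, z.d k * ∑ l, z.omega k.succ l.succ * z.d l =
        sp (∑ k, z.d k • z.col k.succ) (∑ k, z.d k • z.col k.succ) := by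
      simp only [map_sum, LinearMap.sum_apply, map_smul, LinearMap.smul_apply, smul_eq_mul,
        sp_col_succ_succ, Finset.mul_sum]
      rw [Finset.sum_comm]
      refine Finset.sum_congr rfl fun k _ => Finset.sum_congr rfl fun l _ => by ring
    rw [e, sp_self h2]
  refine mem_fil1.2 ⟨(2 * ϖ) • v, by simp, ?_, fun k => ?_⟩
  · rw [sp_comb_right, Fin.sum_univ_succ, sp_self h2, mul_zero, zero_add]
    simp only [hs, mul_add, Finset.sum_add_distrib]
    have e1 : ∑ k, z.d k * ∑ l, z.omega k.succ l.succ * (z.d l * v 0) = 0 := by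
      have : ∑ k, z.d k * ∑ l, z.omega k.succ l.succ * (z.d l * v 0) =
          (∑ k, z.d k * ∑ l, z.omega k.succ l.succ * z.d l) * v 0 := by
        simp only [Finset.mul_sum, Finset.sum_mul]
        refine Finset.sum_congr rfl fun k _ => Finset.sum_congr rfl fun l _ => by ring
      rw [this, h0, zero_mul]
    rw [e1, zero_add]
    simp only [Finset.mul_sum]
    rw [Finset.sum_comm]
    refine Finset.sum_congr rfl fun k _ => ?_
    rw [sp_neg, sp_col_succ_zero, ← Finset.sum_neg_distrib, Finset.mul_sum]
    refine Finset.sum_congr rfl fun l _ => ?_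
    rw [omega, midForm_neg, ← omega]; ring
  · simp only [hs, Finset.mul_sum, Pi.smul_apply, smul_eq_mul]
    rw [Finset.sum_comm]
    have : ∀ l, ∑ i, z.D k i * (z.omega i.succ l.succ * (z.d l * v 0 + v l.succ)) =
        if k = l then (2 * ϖ) * (z.d l * v 0 + v l.succ) else 0 := fun l => by
      rw [← zero_mul (z.d l * v 0 + v l.succ), ← ite_mul, ← hz.D_omega, Finset.sum_mul]
      exact Finset.sum_congr rfl fun _ _ => by ring
    simp only [this, Finset.sum_ite_eq, Finset.mem_univ, if_true]
    ring

theorem fst_of_mem_fil0 {x : Coord h R} (hx : x ∈ z.fil0) : x.1 = 0 := by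
  obtain ⟨v, rfl⟩ := mem_fil0.1 hx; rfl

theorem add_mem_fil0 {x : Coord h R} (hx : x ∈ z.fil1 ϖ) :
    ((0, x.1 + (2 * ϖ) • x.2) : Coord h R) ∈ z.fil0 := by
  obtain ⟨ψ, h1, -, -⟩ := mem_fil1.1 hx
  exact mem_fil0.2 ⟨ψ, by rw [h1]⟩

/-- The vector of parameters of `ℱ₁` at which the linear forms `ψ_0, ω(X_1, ·), …, ω(X_q, ·)` form
the `k`-th unit vector. -/
def dual (rows : Fin q ↪ Fin (2 * h)) (k : Fin q) : Idx h → R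
  | none => 0
  | some none => 0
  | some (some l) => (Pi.single (rows k).rev (sgn R (rows k)) : Fin (2 * h) → R) l

theorem sp_col_succ_dual {k : Fin q} {x : Coord h R} (hx : proj1 R x = dual rows k) (j : Fin q) :
    sp (z.col j.succ) x.2 = z.M (rows k) j.succ := by
  have h1 : x.2 none = 0 := congrFun hx none
  have h2 : (fun l => x.2 (some (some l))) = Pi.single (rows k).rev (sgn R (rows k)) :=
    funext fun l => congrFun hx (some (some l))
  rw [sp_col_succ, h1, h2, midForm_dual, mul_zero, zero_add]

theorem Valid.psi_eq (hz : z.Valid ϖ rows) {x : Coord h R} {ψ : Fin (q + 1) → R}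
    (hψ : x.1 + (2 * ϖ) • x.2 = z.comb ψ) :
    ψ = fun j => x.1 (piv rows j) + 2 * ϖ * x.2 (piv rows j) := by
  funext j
  rw [← hz.comb_piv ψ j, ← hψ]; rfl

/-- The pair of submodules determines the data: the generators of `ℱ₀` are recovered through
`proj0`, and `d` and `D` are read off from the vectors of `ℱ₁` with `proj1 x = dual rows k`. -/
theorem Valid.ext {z' : Data h q R} (hz : z.Valid ϖ rows) (hz' : z'.Valid ϖ rows)
    (e0 : z.fil0 = z'.fil0) (e1 : z.fil1 ϖ = z'.fil1 ϖ) : z = z' := by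
  have hcol : ∀ j, z.col j = z'.col j := by
    intro j
    have m1 : ((0, z.col j) : Coord h R) ∈ z'.fil0 := by
      rw [← e0]; exact mem_fil0.2 ⟨Pi.single j 1, by simp [comb_apply, Pi.single_apply]⟩
    have m2 : ((0, z'.col j) : Coord h R) ∈ z'.fil0 :=
      mem_fil0.2 ⟨Pi.single j 1, by simp [comb_apply, Pi.single_apply]⟩
    have := hz'.eq_zero_of_proj0 (z'.fil0.sub_mem m1 m2) (by
      funext i
      simp [hz.col_piv, hz'.col_piv])
    exact congrArg Prod.snd (sub_eq_zero.1 this)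
  have hx : ∀ k, ∃ x ∈ z.fil1 ϖ, proj1 R x = dual rows k := fun k => by
    have : (dual rows k : Idx h → R) ∈ (z.fil1 ϖ).map (proj1 R) := by
      rw [hz.map_proj1_fil1]; trivial
    exact this
  choose x hx hxk using hx
  have hx' := fun k => e1 ▸ hx k
  choose ψ h1 h2 h3 using fun k => mem_fil1.1 (hx k)
  choose χ h4 h5 h6 using fun k => mem_fil1.1 (hx' k)
  have hψχ : ∀ k, ψ k = χ k := fun k => by rw [hz.psi_eq (h1 k), hz'.psi_eq (h4 k)]
  have hψ0 : ∀ k, ψ k 0 = 0 := fun k => by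
    have a : (x k).1 none = 0 := congrFun (hxk k) (some none)
    have b : (x k).2 none = 0 := congrFun (hxk k) none
    simp [hz.psi_eq (h1 k), a, b]
  have hd : z.d = z'.d := by
    funext k
    have a := h2 k
    have b := h5 k
    simp only [sp_col_succ_dual (hxk k), hz.M_rows, hz'.M_rows] at a b
    rw [hcol] at a
    simpa [eq_comm] using a.symm.trans b
  refine Data.ext ?_ hd ?_ ?_
  · exact congrFun (hcol 0) (some none)
  · ext l k
    have a := h3 k l
    have b := h6 k l
    simp only [sp_col_succ_dual (hxk k), hz.M_rows, hz'.M_rows] at a b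
    rw [← hψχ] at b
    have := a.symm.trans b
    simpa [hψ0, eq_comm] using this
  · ext k j
    exact congrFun (hcol j) (some (some k))

end Data

open Data in
/-- A pair `(N₀, N₁)` with `N₀ ⊆ N₁`, `N₁` isotropic, `t - π = 0` on `N₀` and `(t + π) N₁ ⊆ N₀`
that is in general position with respect to the coordinates `proj0`, `proj1` is given by
the equations of a chart. -/
theorem exists_data (ϖ : R) (h2 : IsUnit (2 : R)) (rows : Fin q ↪ Fin (2 * h))
    {N₀ N₁ : Submodule R (Coord h R)}
    (fst_zero : ∀ x ∈ N₀, x.1 = 0) (le : N₀ ≤ N₁) (iso : ∀ x ∈ N₁, ∀ y ∈ N₁, bil x y = 0)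
    (add_mem : ∀ x ∈ N₁, ((0, x.1 + (2 * ϖ) • x.2) : Coord h R) ∈ N₀)
    (top0 : N₀.map (proj0 R rows) = ⊤) (inj0 : ∀ x ∈ N₀, proj0 R rows x = 0 → x = 0)
    (top1 : N₁.map (proj1 R) = ⊤) :
    ∃ z : Data h q R, z.Valid ϖ rows ∧ z.fil0 = N₀ ∧ z.fil1 ϖ = N₁ := by
  classical
  have hX : ∀ j, ∃ X : Idx h → R, ((0, X) : Coord h R) ∈ N₀ ∧
      ∀ i, X (piv rows i) = if i = j then 1 else 0 := by
    intro j
    obtain ⟨x, hx, hxj⟩ : Pi.single j 1 ∈ N₀.map (proj0 R rows) := by rw [top0]; trivial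
    refine ⟨x.2, ?_, fun i => ?_⟩
    · rw [← fst_zero x hx]; exact hx
    · have := congrFun hxj i
      rwa [proj0_apply, Pi.single_apply] at this
  choose X hXN hXp using hX
  have hx0 : ∃ x ∈ N₁, proj1 R x = Pi.single (some none) 1 := by
    have : (Pi.single (some none) 1 : Idx h → R) ∈ N₁.map (proj1 R) := by rw [top1]; trivial
    exact this
  have hxk : ∀ k : Fin q, ∃ x ∈ N₁, proj1 R x = dual rows k := fun k => by
    have : (dual rows k : Idx h → R) ∈ N₁.map (proj1 R) := by rw [top1]; trivial
    exact this
  obtain ⟨x0, hx0, hx0p⟩ := hx0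
  choose xs hxs hxsp using hxk
  let ψ : Coord h R → Fin (q + 1) → R := fun x j => x.1 (piv rows j) + 2 * ϖ * x.2 (piv rows j)
  have hψ : ∀ x ∈ N₁, x.1 + (2 * ϖ) • x.2 = ∑ j, ψ x j • X j := by
    intro x hx
    have m2 : ((0, ∑ j, ψ x j • X j) : Coord h R) ∈ N₀ := by
      have : ((0, ∑ j, ψ x j • X j) : Coord h R) = ∑ j, ψ x j • ((0, X j) : Coord h R) := by
        ext <;> simp [Prod.fst_sum, Prod.snd_sum]
      rw [this]
      exact N₀.sum_mem fun j _ => N₀.smul_mem _ (hXN j)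
    have := inj0 _ (N₀.sub_mem (add_mem x hx) m2) (by
      funext i
      simp [hXp, ψ])
    exact congrArg Prod.snd (sub_eq_zero.1 this)
  -- isotropy of `N₁` in terms of the linear forms `ψ` and `ω(X_j, ·)`
  have hiso : ∀ x ∈ N₁, ∀ y ∈ N₁,
      ∑ j, ψ x j * sp (X j) y.2 + ∑ j, ψ y j * sp (X j) x.2 = 0 := by
    intro x hx y hy
    have h1 := iso x hx y hy
    have e1 : x.1 = ∑ j, ψ x j • X j - (2 * ϖ) • x.2 := by rw [← hψ x hx]; abel
    have e2 : y.1 = ∑ j, ψ y j • X j - (2 * ϖ) • y.2 := by rw [← hψ y hy]; abel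
    have e3 : sp y.2 x.2 = - sp x.2 y.2 := sp_neg _ _
    rw [bil, e1, e2] at h1
    simp only [map_sub, map_smul, LinearMap.sub_apply, LinearMap.smul_apply, map_sum,
      LinearMap.sum_apply, smul_eq_mul, e3] at h1
    rw [← h1]; ring
  -- orthogonality of `N₀` and `N₁`
  have hort : ∀ x ∈ N₁, ∀ i, 2 * ϖ * sp (X i) x.2 = ∑ j, ψ x j * sp (X i) (X j) := by
    intro x hx i
    have h1 := iso _ (le (hXN i)) x hx
    have e1 : x.1 = ∑ j, ψ x j • X j - (2 * ϖ) • x.2 := by rw [← hψ x hx]; abel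
    rw [bil, e1] at h1
    simp only [map_zero, LinearMap.zero_apply, zero_add, map_sub, map_smul, LinearMap.sub_apply,
      LinearMap.smul_apply, map_sum, LinearMap.sum_apply, smul_eq_mul] at h1
    have e2 := sp_neg (X i) x.2
    rw [e2] at h1
    have e3 : ∑ j, ψ x j * sp (X i) (X j) = -∑ j, ψ x j * sp (X j) (X i) := by
      rw [← Finset.sum_neg_distrib]
      exact Finset.sum_congr rfl fun j _ => by rw [sp_neg (X j)]; ring
    rw [e3]
    linear_combination h1
  have hX0 : ∀ j : Fin q, X j.succ none = 0 := fun j => by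
    have := hXp j.succ 0
    rwa [piv_zero, if_neg (Fin.succ_ne_zero j).symm] at this
  have hX1 : X 0 none = 1 := by
    have := hXp 0 0
    rwa [piv_zero, if_pos rfl] at this
  have hspX : ∀ (j : Fin q) c, sp (X j.succ) c = X j.succ (some none) * c none +
      midForm (fun k => X j.succ (some (some k))) (fun k => c (some (some k))) := fun j c => by
    simp [sp_apply, hX0]
  -- on `x0, xs 1, …, xs q` the forms `ψ_0, ω(X_1, ·), …, ω(X_q, ·)` take unit vectors as values
  have v00 : ψ x0 0 = 1 := by
    have a : x0.1 none = 1 := congrFun hx0p (some none)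
    have b : x0.2 none = 0 := congrFun hx0p none
    simp [ψ, a, b]
  have v0 : ∀ j : Fin q, sp (X j.succ) x0.2 = 0 := fun j => by
    have b : x0.2 none = 0 := congrFun hx0p none
    have c : (fun k => x0.2 (some (some k))) = 0 := funext fun k => congrFun hx0p (some (some k))
    simp [hspX, b, c]
  have vk0 : ∀ k, ψ (xs k) 0 = 0 := fun k => by
    have a : (xs k).1 none = 0 := congrFun (hxsp k) (some none)
    have b : (xs k).2 none = 0 := congrFun (hxsp k) none
    simp [ψ, a, b]
  have vk : ∀ k j : Fin q, sp (X j.succ) (xs k).2 = if k = j then 1 else 0 := fun k j => by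
    have b : (xs k).2 none = 0 := congrFun (hxsp k) none
    have c : (fun l => (xs k).2 (some (some l))) = Pi.single (rows k).rev (sgn R (rows k)) :=
      funext fun l => congrFun (hxsp k) (some (some l))
    rw [hspX, b, c, midForm_dual, mul_zero, zero_add]
    have := hXp j.succ k.succ
    rw [piv_succ] at this
    rw [this]; simp
  have r1 : ∀ x ∈ N₁, ∀ k : Fin q, ψ x k.succ = -(sp (X 0) (xs k).2 * ψ x 0) +
      ∑ l : Fin q, -ψ (xs k) l.succ * sp (X l.succ) x.2 := by
    intro x hx k
    have := hiso x hx (xs k) (hxs k)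
    simp only [Fin.sum_univ_succ, vk0, vk, mul_ite, mul_one, mul_zero, Finset.sum_ite_eq,
      Finset.mem_univ, if_true] at this
    simp only [neg_mul, Finset.sum_neg_distrib]
    linear_combination this
  have r0 : sp (X 0) x0.2 = 0 := by
    have := hiso x0 hx0 x0 hx0
    simp only [Fin.sum_univ_succ, v00, v0, mul_zero, Finset.sum_const_zero, add_zero,
      one_mul] at this
    rw [← two_mul] at this
    exact h2.mul_right_eq_zero.1 this
  have r2 : ∀ k : Fin q, ψ x0 k.succ = -sp (X 0) (xs k).2 := fun k => by
    rw [r1 x0 hx0 k]; simp [v00, v0]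
  have r3 : ∀ x ∈ N₁, sp (X 0) x.2 = ∑ k, sp (X 0) (xs k).2 * sp (X k.succ) x.2 := by
    intro x hx
    have := hiso x hx x0 hx0
    simp only [Fin.sum_univ_succ, v00, v0, r0, r2, mul_zero, Finset.sum_const_zero, add_zero,
      one_mul, zero_add, neg_mul, Finset.sum_neg_distrib] at this
    linear_combination this
  have r4 : ∀ k l : Fin q, -ψ (xs k) l.succ = ψ (xs l) k.succ := fun k l => by
    rw [r1 (xs l) (hxs l) k]
    simp [vk, vk0]
  let z : Data h q R :=
    { w := X 0 (some none)
      d := fun k => sp (X 0) (xs k).2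
      D := Matrix.of fun k l => -ψ (xs k) l.succ
      M := Matrix.of fun k j => X j (some (some k)) }
  have hom : ∀ j k : Fin q, z.omega j.succ k.succ = sp (X j.succ) (X k.succ) := fun j k => by
    rw [hspX, hX0, mul_zero, zero_add]; rfl
  have hlast : ∀ j : Fin q, X j.succ (some none) =
      ∑ k, z.omega j.succ k.succ * z.d k - z.omega j.succ 0 := fun j => by
    have a := hort x0 hx0 j.succ
    rw [v0, mul_zero, Fin.sum_univ_succ, v00, hspX j (X 0), hX1] at a
    simp only [r2, neg_mul, Finset.sum_neg_distrib] at a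
    have e : ∑ k, z.omega j.succ k.succ * z.d k =
        ∑ k, sp (X 0) (xs k).2 * sp (X j.succ) (X k.succ) :=
      Finset.sum_congr rfl fun k _ => by rw [hom, mul_comm]
    have e' : z.omega j.succ 0 =
        midForm (fun k => X j.succ (some (some k))) (fun k => X 0 (some (some k))) := rfl
    rw [e, e']
    linear_combination -a
  have hcol : ∀ j, z.col j = X j := by
    intro j
    funext i
    match i with
    | none =>
      refine Fin.cases ?_ (fun p => ?_) j
      · rw [hX1]; rfl
      · rw [hX0]; rfl
    | some none =>
      refine Fin.cases ?_ (fun p => ?_) j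
      · rfl
      · rw [hlast]; rfl
    | some (some k) => rfl
  have hz : z.Valid ϖ rows := by
    refine ⟨fun p j => ?_, fun p p' => ?_, fun p p' => ?_⟩
    · have := hXp j p.succ
      rw [piv_succ] at this
      simpa [z, eq_comm] using this
    · simp only [z, Matrix.of_apply]
      rw [r4 p' p]; ring
    · have a := hort (xs p) (hxs p) p'.succ
      rw [vk, Fin.sum_univ_succ, vk0, zero_mul, zero_add] at a
      rw [mul_ite, mul_one, mul_zero] at a
      rw [a]
      refine Finset.sum_congr rfl fun k _ => ?_
      rw [hom, sp_neg]
      simp [z]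
  have hcomb : ∀ v, z.comb v = ∑ j, v j • X j := fun v => by
    rw [comb_apply]; simp only [hcol]
  refine ⟨z, hz, ?_, ?_⟩
  · refine eq_of_le_of_map_eq_top (proj0 R rows) (fun x hx => ?_) hz.map_proj0_fil0 inj0
    obtain ⟨v, rfl⟩ := mem_fil0.1 hx
    have : ((0, z.comb v) : Coord h R) = ∑ j, v j • ((0, X j) : Coord h R) := by
      rw [hcomb]
      ext <;> simp [Prod.fst_sum, Prod.snd_sum]
    rw [this]
    exact N₀.sum_mem fun j _ => N₀.smul_mem _ (hXN j)
  · refine (eq_of_le_of_map_eq_top (proj1 R) (fun x hx => ?_) top1 (fun x hx h0 => ?_)).symm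
    · refine mem_fil1.2 ⟨ψ x, by rw [hcomb, hψ x hx], ?_, fun k => ?_⟩
      · simp only [hcol]; exact r3 x hx
      · simp only [hcol]; exact r1 x hx k
    · exact eq_zero_of_proj1_eq_zero hz.map_proj1_fil1 (fun y hy => hz.bil_eq_zero hx hy) h0

end ChartCoord

/-! ### Direct summands and determinants -/

section summands

open SplitHermitian

variable {R P : Type u} {R' P' J : Type*} [CommRing R] [CommRing R'] [AddCommGroup P] [Module R P]
  [AddCommGroup P'] [Module R' P'] [Fintype J]

theorem isSummandOfRank_of_map_eq_top {N : Submodule R P} (g : P →ₗ[R] (J → R))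
    (top : N.map g = ⊤) (inj : ∀ x ∈ N, g x = 0 → x = 0) :
    IsSummandOfRank (Fintype.card J) N := by
  refine ⟨⟨LinearMap.ker g, ?_⟩, fun 𝔭 => ?_⟩
  · constructor
    · rw [Submodule.disjoint_def]
      exact fun x hx h0 => inj x hx h0
    · rw [codisjoint_iff, eq_top_iff]
      intro x _
      obtain ⟨n, hn, hnx⟩ : g x ∈ N.map g := by rw [top]; trivial
      rw [← add_sub_cancel n x]
      exact Submodule.add_mem_sup hn (by rw [LinearMap.mem_ker, map_sub, hnx, sub_self])
  · have : Nontrivial R := 𝔭.nontrivial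
    have e : N ≃ₗ[R] (J → R) := LinearEquiv.ofBijective (g.domRestrict N) ⟨by
      rw [injective_iff_map_eq_zero]
      exact fun x hx => Subtype.ext (inj x x.2 hx), fun v => by
        obtain ⟨n, hn, hnx⟩ : v ∈ N.map g := by rw [top]; trivial
        exact ⟨⟨n, hn⟩, hnx⟩⟩
    rw [Module.rankAtStalk_eq_of_equiv e, Module.rankAtStalk_eq_finrank_of_free]
    simp

/-- If a submodule of rank `k` generates, after base change, a submodule that surjects onto a free
module of rank `k`, then this surjection is an isomorphism. -/
theorem eq_zero_of_map_span_eq_top [Algebra R R'] [Module R P'] [IsScalarTower R R' P']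
    [Module.Finite R P] [Module.Projective R P] {N : Submodule R P}
    (hN : IsSummandOfRank (Fintype.card J) N) (φ : P →ₗ[R] P') (g : P' →ₗ[R'] (J → R'))
    (top : (Submodule.span R' (φ '' N)).map g = ⊤) :
    ∀ x ∈ Submodule.span R' (φ '' N), g x = 0 → x = 0 := by
  obtain ⟨⟨N', hc⟩, hr⟩ := hN
  have hs : N.projectionOnto N' hc ∘ₗ N.subtype = LinearMap.id := by
    ext x; simp
  have : Module.Projective R N := Module.Projective.of_split _ _ hs
  have : Module.Finite R N := Module.Finite.of_surjective (N.projectionOnto N' hc)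
    (LinearMap.range_eq_top.1 (Submodule.range_projectionOnto hc))
  let L : R' ⊗[R] N →ₗ[R'] P' := (φ ∘ₗ N.subtype).liftBaseChange R'
  have hL : LinearMap.range L = Submodule.span R' (φ '' N) := by
    rw [LinearMap.range_liftBaseChange]
    congr 1
    ext x; simp
  have hb : Function.Bijective (g ∘ₗ L) := by
    refine Module.bijective_of_surjective_of_rankAtStalk_eq ?_ fun 𝔪 _ => ?_
    · rw [← LinearMap.range_eq_top, LinearMap.range_comp, hL, top]
    · have : Nontrivial R' := (⟨𝔪, inferInstance⟩ : PrimeSpectrum R').nontrivial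
      rw [Module.rankAtStalk_baseChange, hr, Module.rankAtStalk_eq_finrank_of_free]
      simp
  intro x hx h0
  rw [← hL] at hx
  obtain ⟨y, rfl⟩ := hx
  rw [show y = 0 from hb.1 (by rw [map_zero]; exact h0), map_zero]

variable [DecidableEq J]

/-- The ideal of all determinants of `g x_1, …, g x_k` with `x_i ∈ N`, for a map `g` to a free
module of rank `k`. Its vanishing locus is the complement of the locus where `N` surjects. -/
def detIdeal (g : P →ₗ[R] (J → R)) (N : Submodule R P) : Ideal R :=
  Ideal.span (Set.range fun x : J → N => Matrix.det (Matrix.of fun i => g (x i)))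

theorem exists_eq_single (g : P →ₗ[R] (J → R)) {N : Submodule R P} {r : R} (hr : r ∈ detIdeal g N)
    (j : J) : ∃ n ∈ N, g n = Pi.single j r := by
  induction hr using Submodule.span_induction with
  | zero => exact ⟨0, N.zero_mem, by simp⟩
  | add r r' _ _ h h' =>
    obtain ⟨n, hn, e⟩ := h
    obtain ⟨n', hn', e'⟩ := h'
    exact ⟨n + n', N.add_mem hn hn', by rw [map_add, e, e', Pi.single_add]⟩
  | smul c r _ h =>
    obtain ⟨n, hn, e⟩ := h
    exact ⟨c • n, N.smul_mem c hn, by rw [map_smul, e, ← Pi.single_smul]⟩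
  | mem r hr =>
    obtain ⟨x, rfl⟩ := hr
    -- Cramer's rule
    let A : Matrix J J R := Matrix.of fun i => g (x i)
    refine ⟨∑ i, A.adjugate j i • (x i : P), N.sum_mem fun i _ => N.smul_mem _ (x i).2, ?_⟩
    rw [map_sum]
    simp only [map_smul]
    have h := congrFun (Matrix.adjugate_mul A) j
    funext l
    have h' := congrFun h l
    rw [Matrix.mul_apply] at h'
    simpa [A, Finset.sum_apply, Matrix.one_apply, Pi.single_apply, eq_comm] using h'

theorem det_mem_of_span {S : Set P'} {I : Ideal R'} (g : P' →ₗ[R'] (J → R'))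
    (hS : ∀ x : J → P', (∀ j, x j ∈ S) → Matrix.det (Matrix.of fun i => g (x i)) ∈ I)
    (x : J → P') (hx : ∀ j, x j ∈ Submodule.span R' S) :
    Matrix.det (Matrix.of fun i => g (x i)) ∈ I := by
  let D : AlternatingMap R' P' R' J := Matrix.detRowAlternating.compLinearMap g
  have hD : ∀ x, D x = Matrix.det (Matrix.of fun i => g (x i)) := fun x => rfl
  rw [← hD]
  have key : ∀ t : Finset J, ∀ x : J → P', (∀ j ∈ t, x j ∈ Submodule.span R' S) →
      (∀ j ∉ t, x j ∈ S) → D x ∈ I := by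
    intro t
    induction t using Finset.induction_on with
    | empty => exact fun x _ h => by rw [hD]; exact hS x fun j => h j (Finset.notMem_empty j)
    | insert a t ha ih =>
      intro x h1 h2
      have : ∀ y ∈ Submodule.span R' S, D (Function.update x a y) ∈ I := by
        intro y hy
        induction hy using Submodule.span_induction with
        | mem y hy =>
          refine ih _ (fun j hj => ?_) (fun j hj => ?_)
          · rw [Function.update_of_ne (by rintro rfl; exact ha hj)]
            exact h1 j (Finset.mem_insert_of_mem hj)
          · by_cases hja : j = a
            · subst hja; rwa [Function.update_self]
            · rw [Function.update_of_ne hja]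
              exact h2 j (by simp [hja, hj])
        | zero => rw [D.map_update_zero]; exact I.zero_mem
        | add y y' _ _ h h' => rw [D.map_update_add]; exact I.add_mem h h'
        | smul c y _ h => rw [D.map_update_smul]; exact I.mul_mem_left c h
      have h3 := this (x a) (h1 a (Finset.mem_insert_self a t))
      rwa [Function.update_eq_self] at h3
  exact key Finset.univ x (fun j _ => hx j) (fun j hj => absurd (Finset.mem_univ j) hj)

theorem map_span_eq_top_iff (f : R →+* R') (φ : P → P') (g : P →ₗ[R] (J → R))
    (g' : P' →ₗ[R'] (J → R')) (hφ : ∀ x j, g' (φ x) j = f (g x j)) (N : Submodule R P) :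
    (Submodule.span R' (φ '' N)).map g' = ⊤ ↔ (detIdeal g N).map f = ⊤ := by
  constructor
  · intro h
    rw [Ideal.eq_top_iff_one]
    have hy : ∀ j, ∃ y ∈ Submodule.span R' (φ '' N), g' y = Pi.single j 1 := fun j => by
      have : (Pi.single j 1 : J → R') ∈ (Submodule.span R' (φ '' N)).map g' := by
        rw [h]; trivial
      exact this
    choose y hy hyj using hy
    have := det_mem_of_span (I := (detIdeal g N).map f) g' (S := φ '' N) (fun x hx => ?_) y hy
    · have e : (Matrix.of fun i => g' (y i)) = (1 : Matrix J J R') := by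
        ext i j
        rw [Matrix.of_apply, hyj, Matrix.one_apply, Pi.single_apply]
        simp only [eq_comm]
      rwa [e, Matrix.det_one] at this
    · choose n hn hnx using hx
      have e : (Matrix.of fun i => g' (x i)) =
          f.mapMatrix (Matrix.of fun i => g (n i)) := by
        ext i j
        rw [Matrix.of_apply, ← hnx, hφ]; rfl
      rw [e, ← RingHom.map_det]
      exact Ideal.mem_map_of_mem f (Ideal.subset_span ⟨fun i => ⟨n i, hn i⟩, rfl⟩)
  · intro h
    have key : ∀ r ∈ (detIdeal g N).map f, ∀ j,
        Pi.single j r ∈ (Submodule.span R' (φ '' N)).map g' := by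
      intro r hr j
      induction hr using Submodule.span_induction with
      | zero => rw [Pi.single_zero]; exact Submodule.zero_mem _
      | add r r' _ _ h h' => rw [Pi.single_add]; exact Submodule.add_mem _ h h'
      | smul c r _ h => rw [Pi.single_smul]; exact Submodule.smul_mem _ c h
      | mem r hr =>
        obtain ⟨r, hr, rfl⟩ := hr
        obtain ⟨n, hn, e⟩ := exists_eq_single g hr j
        refine ⟨φ n, Submodule.subset_span ⟨n, hn, rfl⟩, ?_⟩
        funext i
        rw [hφ, e, Pi.single_apply, Pi.single_apply]
        split_ifs <;> simp
    rw [eq_top_iff]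
    intro v _
    rw [← Finset.univ_sum_single v]
    exact Submodule.sum_mem _ fun j _ => key (v j) (by rw [h]; trivial) j

theorem map_span_eq_top (f : R →+* R') (φ : P → P')
    (g : P →ₗ[R] (J → R)) (g' : P' →ₗ[R'] (J → R')) (hφ : ∀ x j, g' (φ x) j = f (g x j))
    {N : Submodule R P} (top : N.map g = ⊤) : (Submodule.span R' (φ '' N)).map g' = ⊤ := by
  have h : (detIdeal g N).map (RingHom.id R) = ⊤ := by
    rw [← map_span_eq_top_iff (RingHom.id R) id g g (fun _ _ => rfl)]
    simpa using top
  rw [Ideal.map_id] at h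
  rw [map_span_eq_top_iff f φ g g' hφ, h, Ideal.map_top]

end summands

/-- Among linear forms `c_k` that are jointly injective on a space of dimension `q`, some `q` are
jointly injective. -/
theorem exists_embedding_injective {κ U K : Type*} [Field κ] [AddCommGroup U] [Module κ U]
    [FiniteDimensional κ U] {q : ℕ} (hq : Module.finrank κ U = q) (c : K → Module.Dual κ U)
    (hc : ∀ x, (∀ k, c k x = 0) → x = 0) :
    ∃ rows : Fin q ↪ K, ∀ x, (∀ p, c (rows p) x = 0) → x = 0 := by
  have htop : Submodule.span κ (Set.range c) = ⊤ := by
    by_contra h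
    obtain ⟨g, hg, hle⟩ := Submodule.exists_le_ker_of_lt_top _ (lt_top_iff_ne_top.2 h)
    obtain ⟨x, rfl⟩ := (Module.evalEquiv κ U).surjective g
    refine hg ?_
    rw [hc x fun k => ?_, map_zero]
    have := hle (Submodule.subset_span ⟨k, rfl⟩)
    simpa using this
  have hfr : Module.finrank κ (Submodule.span κ (Set.range c)) = q := by
    rw [htop, finrank_top, Subspace.dual_finrank_eq, hq]
  obtain ⟨b, hb, hspan, hli⟩ := Submodule.exists_fun_fin_finrank_span_eq κ (Set.range c)
  choose r hr using hb
  refine ⟨⟨fun p => r (Fin.cast hfr.symm p), fun p p' h => ?_⟩, fun x hx => ?_⟩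
  · have := hli.injective ((hr _).symm.trans ((congrArg c h).trans (hr _)))
    simpa using this
  · have h : ∀ g ∈ Submodule.span κ (Set.range b), g x = 0 := by
      intro g hg
      induction hg using Submodule.span_induction with
      | mem g hg =>
        obtain ⟨p, rfl⟩ := hg
        rw [← hr]
        exact hx (Fin.cast hfr p)
      | zero => rfl
      | add g g' _ _ h h' => rw [LinearMap.add_apply, h, h', add_zero]
      | smul a g _ h => rw [LinearMap.smul_apply, h, smul_zero]
    refine hc x fun k => h _ ?_
    rw [hspan, htop]; trivial

/-- Among linear forms `f ≠ 0` and `c_k` that are jointly injective on a space of dimension `q + 1`,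
`f` and some `q` of the `c_k` are jointly injective. -/
theorem exists_embedding_injective_ker {κ W K : Type*} [Field κ] [AddCommGroup W] [Module κ W]
    [FiniteDimensional κ W] {q : ℕ} (hq : Module.finrank κ W = q + 1) (f : Module.Dual κ W)
    (hf : f ≠ 0) (c : K → Module.Dual κ W) (hc : ∀ x, f x = 0 → (∀ k, c k x = 0) → x = 0) :
    ∃ rows : Fin q ↪ K, ∀ x, f x = 0 → (∀ p, c (rows p) x = 0) → x = 0 := by
  have hker : Module.finrank κ (LinearMap.ker f) = q := by
    have := LinearMap.finrank_range_add_finrank_ker f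
    rw [LinearMap.range_eq_top.2 (LinearMap.surjective hf), finrank_top, Module.finrank_self,
      hq] at this
    omega
  obtain ⟨rows, hrows⟩ := exists_embedding_injective hker
    (fun k => (c k).domRestrict (LinearMap.ker f)) fun x hx => Subtype.ext (hc x.1 x.2 hx)
  exact ⟨rows, fun x hx h => congrArg Subtype.val (hrows ⟨x, hx⟩ h)⟩

/-! ### The lattice `Λ_m` -/

namespace SplitHermitian

open ChartCoord

variable {O₀ F₀ OF F V : Type u}
  [CommRing O₀] [IsDomain O₀] [IsDiscreteValuationRing O₀]
  [Field F₀] [Algebra O₀ F₀] [IsFractionRing O₀ F₀]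
  [Field F] [Algebra F₀ F] [Algebra O₀ F] [IsScalarTower O₀ F₀ F]
  [CommRing OF] [Algebra O₀ OF] [Algebra OF F] [IsScalarTower O₀ OF F] [IsIntegralClosure OF O₀ F]
  [AddCommGroup V] [Module F V] [Module OF V] [IsScalarTower OF F V]
  [Module O₀ V] [IsScalarTower O₀ OF V]

section integers

variable {m : ℕ} (H : SplitHermitian O₀ F₀ OF F V m)

/-- `π` does not lie in `F₀`, since `π₀` is not a square. -/
theorem algebraMap_ne_pi (c : F₀) : algebraMap F₀ F c ≠ H.pi := by
  intro h
  have h1 : c ^ 2 = algebraMap O₀ F₀ H.π₀ := by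
    apply (algebraMap F₀ F).injective
    rw [map_pow, h, H.pi_sq]
  obtain ⟨d, hd⟩ := IsIntegrallyClosed.exists_algebraMap_eq_of_isIntegral_pow (R := O₀)
    (x := c) (n := 2) (by norm_num) (by rw [h1]; exact isIntegral_algebraMap)
  have h2 : H.π₀ = d * d := by
    apply IsFractionRing.injective O₀ F₀
    rw [← h1, map_mul, hd, sq]
  rcases H.irreducible_π₀.isUnit_or_isUnit h2 with h3 | h3 <;>
  · exact H.irreducible_π₀.not_isUnit (by rw [h2]; exact h3.mul h3)

theorem sigma_pi_eq : H.σ H.pi = -H.pi := by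
  refine H.sigma_pi.resolve_left fun h => ?_
  have h1 := H.trace_eq H.pi
  rw [h, ← two_mul] at h1
  apply H.algebraMap_ne_pi ((2 : F₀)⁻¹ * Algebra.trace F₀ F H.pi)
  have h2 : (2 : F) ≠ 0 := by
    have := (map_ne_zero (algebraMap F₀ F)).2 H.two_ne_zero'
    rwa [map_ofNat] at this
  rw [map_mul, h1, map_inv₀, map_ofNat, inv_mul_cancel_left₀ h2]

theorem algebraMap_OF_injective (_ : SplitHermitian O₀ F₀ OF F V m) :
    Function.Injective (algebraMap OF F) :=
  IsIntegralClosure.algebraMap_injective OF O₀ F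

theorem algebraMap_algebraMap_OF (_ : SplitHermitian O₀ F₀ OF F V m) (a : O₀) :
    algebraMap OF F (algebraMap O₀ OF a) = algebraMap F₀ F (algebraMap O₀ F₀ a) := by
  rw [← IsScalarTower.algebraMap_apply, ← IsScalarTower.algebraMap_apply]

/-- `O_F` is generated by `1` and `π` over `O_{F₀}`: the coefficients of an integral element `z` are
half the traces of `z` and of `π⁻¹ z`. -/
theorem exists_eq_add_mul (z : OF) :
    ∃ a b : O₀, z = algebraMap O₀ OF a + algebraMap O₀ OF b * H.ϖ := by
  have hz : IsIntegral O₀ (algebraMap OF F z) := (IsIntegralClosure.isIntegral O₀ F z).map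
    (IsScalarTower.toAlgHom O₀ OF F)
  have hpi : IsIntegral O₀ H.pi :=
    (IsIntegralClosure.isIntegral O₀ F H.ϖ).map (IsScalarTower.toAlgHom O₀ OF F)
  obtain ⟨a, ha⟩ := H.exists_of_isIntegral (hpi.mul hz)
  obtain ⟨b, hb⟩ := H.exists_of_isIntegral (z := H.pi⁻¹ * algebraMap OF F z)
    (by rwa [mul_inv_cancel_left₀ H.pi_ne_zero])
  refine ⟨a, b, H.algebraMap_OF_injective ?_⟩
  have h2 : (2 : F) ≠ 0 := by
    have := (map_ne_zero (algebraMap F₀ F)).2 H.two_ne_zero'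
    rwa [map_ofNat] at this
  have e : algebraMap OF F H.ϖ = H.pi := rfl
  rw [map_add, map_mul, H.algebraMap_algebraMap_OF, H.algebraMap_algebraMap_OF, ha, hb, e, map_mul,
    map_mul, H.trace_eq, H.trace_eq, map_mul, map_inv₀, map_inv₀, H.sigma_pi_eq, map_ofNat]
  have h0 := H.pi_ne_zero
  field_simp
  ring

theorem eq_zero_of_add_mul_eq_zero {a b : O₀}
    (h : algebraMap O₀ OF a + algebraMap O₀ OF b * H.ϖ = 0) : a = 0 ∧ b = 0 := by
  have h1 := congrArg (algebraMap OF F) h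
  rw [map_zero, map_add, map_mul, H.algebraMap_algebraMap_OF, H.algebraMap_algebraMap_OF] at h1
  have hinj := IsFractionRing.injective O₀ F₀
  have hb : b = 0 := by
    by_contra hb
    have hb' : algebraMap O₀ F₀ b ≠ 0 := fun h => hb (hinj (by rw [h, map_zero]))
    apply H.algebraMap_ne_pi (-(algebraMap O₀ F₀ b)⁻¹ * algebraMap O₀ F₀ a)
    have hb2 := (map_ne_zero (algebraMap F₀ F)).2 hb'
    rw [map_mul, map_neg, map_inv₀]
    have e : algebraMap OF F H.ϖ = H.pi := rfl
    rw [e] at h1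
    field_simp
    linear_combination -h1
  refine ⟨hinj ((algebraMap F₀ F).injective ?_), hb⟩
  simpa [hb] using h1

/-- The basis `1, π` of `O_F` over `O_{F₀}`. -/
def basisOF : Module.Basis (Fin 2) O₀ OF :=
  Module.Basis.mk (v := ![1, H.ϖ])
    (by
      rw [LinearIndependent.pair_iff]
      intro a b h
      rw [Algebra.smul_def, Algebra.smul_def, mul_one] at h
      exact H.eq_zero_of_add_mul_eq_zero h)
    (by
      intro z _
      obtain ⟨a, b, rfl⟩ := H.exists_eq_add_mul z
      rw [← Algebra.smul_def, Algebra.algebraMap_eq_smul_one]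
      exact Submodule.add_mem _ (Submodule.smul_mem _ _ (Submodule.subset_span ⟨0, rfl⟩))
        (Submodule.smul_mem _ _ (Submodule.subset_span ⟨1, rfl⟩)))

theorem gen_linearIndependent : LinearIndependent OF H.gen := by
  have h1 : LinearIndependent F H.gen := by
    have := H.e.linearIndependent.units_smul
      (fun i => if (i : ℕ) < m then (Units.mk0 H.pi H.pi_ne_zero)⁻¹ else 1)
    convert this using 1
    funext i
    simp only [gen, Pi.smul_apply']
    split_ifs
    · rfl
    · exact (one_smul _ _).symm
  exact h1.restrict_scalars (by
    intro a b hab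
    apply H.algebraMap_OF_injective
    simpa [Algebra.smul_def] using hab)

/-- The generators of `Λ_m` as a basis over `O_F`. -/
def basisLattice : Module.Basis (Fin (2 * m)) OF H.latticeM :=
  Module.Basis.span H.gen_linearIndependent

theorem coe_basisLattice (i : Fin (2 * m)) : (H.basisLattice i : V) = H.gen i :=
  congrArg Subtype.val (Module.Basis.span_apply H.gen_linearIndependent i)

theorem phi_gen (i j : Fin (2 * m)) :
    H.φ (H.gen i) (H.gen j) =
      if i = j.rev then (if (i : ℕ) < m then 1 else -1) * H.pi⁻¹ else 0 := by
  have hφ : ∀ i j, H.φ (H.e i) (H.e j) = if i = j.rev then 1 else 0 := fun i j => by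
    simpa using H.split i j.rev
  by_cases hij : i = j.rev
  · have hv : (i : ℕ) + (j : ℕ) + 1 = 2 * m := by
      rw [hij, Fin.val_rev]; omega
    unfold gen
    rw [if_pos hij]
    split_ifs with h1 h2 h2
    · omega
    · simp [hφ, hij]
    · simp [hφ, hij, H.sigma_pi_eq]
    · omega
  · unfold gen
    split_ifs <;> simp [hφ, hij]

theorem trace_eq_zero {z : F} (hz : H.σ z = -z) : Algebra.trace F₀ F z = 0 := by
  apply (algebraMap F₀ F).injective
  rw [H.trace_eq, hz, map_zero, add_neg_cancel]

theorem coe_smul_lattice (c : OF) (x : H.latticeM) :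
    ((c • x : H.latticeM) : V) = algebraMap OF F c • (x : V) := by
  rw [Submodule.coe_smul, algebraMap_smul]

theorem sigma_phi_gen (i j : Fin (2 * m)) :
    H.σ (H.φ (H.gen i) (H.gen j)) = -H.φ (H.gen i) (H.gen j) := by
  rw [phi_gen]
  split_ifs <;> simp [H.sigma_pi_eq]

theorem latticeForm_gen_gen (i j : Fin (2 * m)) :
    H.latticeForm (H.basisLattice i) (H.basisLattice j) = 0 := by
  apply IsFractionRing.injective O₀ F₀
  rw [algebraMap_latticeForm, symForm, coe_basisLattice, coe_basisLattice,
    H.trace_eq_zero (H.sigma_phi_gen i j), mul_zero, map_zero]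

theorem latticeForm_gen_smul (i j : Fin (2 * m)) :
    H.latticeForm (H.basisLattice i) (H.ϖ • H.basisLattice j) =
      if i = j.rev then (if (i : ℕ) < m then -1 else 1) else 0 := by
  apply IsFractionRing.injective O₀ F₀
  have e : algebraMap OF F H.ϖ = H.pi := rfl
  have h2 := H.two_ne_zero'
  rw [algebraMap_latticeForm, symForm, coe_smul_lattice, coe_basisLattice, coe_basisLattice,
    LinearMap.map_smulₛₗ, smul_eq_mul, RingHom.coe_coe, e, H.sigma_pi_eq, phi_gen]
  have ht : Algebra.trace F₀ F (1 : F) = 2 := by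
    rw [← map_one (algebraMap F₀ F), Algebra.trace_algebraMap, H.finrank_eq]; simp
  split_ifs with h h'
  · rw [one_mul, neg_mul, mul_inv_cancel₀ H.pi_ne_zero, map_neg, ht, map_neg, map_one]
    field_simp
  · rw [neg_one_mul, neg_mul_neg, mul_inv_cancel₀ H.pi_ne_zero, ht, map_one]
    field_simp
  · simp

theorem latticeForm_smul_smul (i j : Fin (2 * m)) :
    H.latticeForm (H.ϖ • H.basisLattice i) (H.ϖ • H.basisLattice j) = 0 := by
  apply IsFractionRing.injective O₀ F₀
  have e : algebraMap OF F H.ϖ = H.pi := rfl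
  rw [algebraMap_latticeForm, symForm, coe_smul_lattice, coe_smul_lattice, coe_basisLattice,
    coe_basisLattice, LinearMap.map_smul H.φ, LinearMap.smul_apply,
    LinearMap.map_smulₛₗ, smul_eq_mul, smul_eq_mul, RingHom.coe_coe, e, H.sigma_pi_eq,
    H.trace_eq_zero, mul_zero, map_zero]
  rw [map_mul, map_mul, map_neg, H.sigma_pi_eq, sigma_phi_gen]
  ring

theorem latticeForm_comm (x y : H.latticeM) : H.latticeForm x y = H.latticeForm y x := by
  apply IsFractionRing.injective O₀ F₀
  rw [algebraMap_latticeForm, algebraMap_latticeForm, symForm, symForm, H.hermitian (x : V) y]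
  congr 1
  apply (algebraMap F₀ F).injective
  rw [H.trace_eq, H.trace_eq]
  have : H.σ (H.σ (H.φ x y)) = H.φ x y := by rw [← H.hermitian, ← H.hermitian]
  rw [this, add_comm]

end integers
end SplitHermitian

/-! ### Coordinates on `Λ_m ⊗ R` -/

namespace ChartCoord

variable {h : ℕ}

/-- The numbering of `Idx h`, starting with `0`. -/
def pos (h : ℕ) : Idx h ≃ Fin (2 * (h + 1)) :=
  Equiv.ofBijective
    (fun i => match i with
      | none => ⟨0, by omega⟩
      | some none => ⟨2 * h + 1, by omega⟩
      | some (some k) => ⟨k + 1, by omega⟩) (by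
    rw [Fintype.bijective_iff_injective_and_card]
    refine ⟨fun i j hij => ?_, by simp; omega⟩
    match i, j with
    | none, none => rfl
    | none, some none => simp at hij
    | none, some (some k) => simp at hij
    | some none, none => simp at hij
    | some none, some none => rfl
    | some none, some (some k) =>
      have := k.isLt
      simp at hij
      omega
    | some (some k), none => simp at hij
    | some (some k), some none =>
      have := k.isLt
      simp at hij
      omega
    | some (some k), some (some l) =>
      simp only [Fin.mk.injEq, add_left_inj] at hij
      rw [Fin.ext hij])

@[simp] theorem pos_none : (pos h none : ℕ) = 0 := rfl
@[simp] theorem pos_some_none : (pos h (some none) : ℕ) = 2 * h + 1 := rfl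
@[simp] theorem pos_some_some (k : Fin (2 * h)) : (pos h (some (some k)) : ℕ) = k + 1 := rfl

/-- The opposite index. -/
def op : Idx h → Idx h
  | none => some none
  | some none => none
  | some (some k) => some (some k.rev)

theorem pos_op (i : Idx h) : pos h (op i) = (pos h i).rev := by
  ext
  rw [Fin.val_rev]
  match i with
  | none => simp [op]; omega
  | some none => simp [op]; omega
  | some (some k) =>
    have := k.isLt
    simp only [op, pos_some_some, Fin.val_rev]
    omega

variable {R : Type*} [CommRing R]

theorem sp_single (i j : Idx h) : sp (Pi.single i 1 : Idx h → R) (Pi.single j 1) =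
    if i = op j then (if (pos h i : ℕ) < h + 1 then -1 else 1) else 0 := by
  have e1 (l : Fin (2 * h)) : (fun k => (Pi.single (some (some l)) 1 : Idx h → R) (some (some k))) =
      Pi.single l 1 := by
    funext k; simp [Pi.single_apply]
  match i, j with
  | none, none => simp [sp_apply, op, midForm_apply]
  | none, some none => simp [sp_apply, op, midForm_apply]
  | none, some (some k) => simp [sp_apply, op, midForm_apply]
  | some none, none =>
    have : ¬ 2 * h + 1 < h + 1 := by omega
    simp [sp_apply, op, midForm_apply, -add_lt_add_iff_right, this]
  | some none, some none => simp [sp_apply, op, midForm_apply]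
  | some none, some (some k) => simp [sp_apply, op, midForm_apply]
  | some (some k), none => simp [sp_apply, op, midForm_apply]
  | some (some k), some none => simp [sp_apply, op, midForm_apply]
  | some (some k), some (some l) =>
    simp only [sp_apply, e1, op, midForm_apply, Option.some.injEq, pos_some_some]
    rw [Finset.sum_eq_single k]
    · by_cases hkl : k = l.rev
      · subst hkl
        simp [sgn]
      · have : k.rev ≠ l := fun h => hkl (by rw [← h, Fin.rev_rev])
        simp [hkl, this]
    · intro b _ hb
      simp [hb]
    · simp

/-- The symmetric form in coordinates, as a bilinear form. -/
def bilForm (h : ℕ) (R : Type*) [CommRing R] : LinearMap.BilinForm R (Coord h R) :=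
  LinearMap.mk₂ R bil
    (fun x y z => by rw [bil_comm, bil_add_right, bil_comm z, bil_comm z])
    (fun c x y => by
      simp only [bil, Prod.smul_fst, Prod.smul_snd, map_smul, LinearMap.smul_apply, smul_eq_mul]
      ring)
    bil_add_right
    (fun c x y => by
      simp only [bil, Prod.smul_fst, Prod.smul_snd, map_smul, LinearMap.smul_apply, smul_eq_mul]
      ring)

/-- Multiplication by `t` in coordinates. -/
def tCoord (h : ℕ) {R : Type*} [CommRing R] (ϖ : R) : Coord h R →ₗ[R] Coord h R :=
  ((-ϖ) • LinearMap.fst R _ _).prod (LinearMap.fst R _ _ + ϖ • LinearMap.snd R _ _)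

/-- Base change of coordinates. -/
def mapCoord {R R' : Type*} [CommRing R] [CommRing R'] (f : R →+* R') (x : Coord h R) :
    Coord h R' :=
  (fun i => f (x.1 i), fun i => f (x.2 i))

/-- The change of coordinates from `f_i, t f_i` to `f_i, (t + π) f_i`. -/
def shear (h : ℕ) {R : Type*} [CommRing R] (ϖ : R) : (Fin 2 × Idx h → R) ≃ₗ[R] Coord h R where
  toFun v := (fun i => v (0, i) - ϖ * v (1, i), fun i => v (1, i))
  map_add' v w := by ext <;> simp; ring
  map_smul' r v := by ext <;> simp; ring
  invFun x p := if p.1 = 0 then x.1 p.2 + ϖ * x.2 p.2 else x.2 p.2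
  left_inv v := by
    funext ⟨a, i⟩
    fin_cases a <;> simp
  right_inv x := by ext <;> simp

end ChartCoord

namespace SplitHermitian

open ChartCoord

variable {O₀ F₀ OF F V : Type u}
  [CommRing O₀] [IsDomain O₀] [IsDiscreteValuationRing O₀]
  [Field F₀] [Algebra O₀ F₀] [IsFractionRing O₀ F₀]
  [Field F] [Algebra F₀ F] [Algebra O₀ F] [IsScalarTower O₀ F₀ F]
  [CommRing OF] [Algebra O₀ OF] [Algebra OF F] [IsScalarTower O₀ OF F] [IsIntegralClosure OF O₀ F]
  [AddCommGroup V] [Module F V] [Module OF V] [IsScalarTower OF F V]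
  [Module O₀ V] [IsScalarTower O₀ OF V] {h : ℕ} (H : SplitHermitian O₀ F₀ OF F V (h + 1))

/-- The `O_{F₀}`-basis of `Λ_m` formed by the generators `f_i` and by the `t f_i`. -/
def basisO : Module.Basis (Fin 2 × Idx h) O₀ H.latticeM :=
  (H.basisOF.smulTower H.basisLattice).reindex ((Equiv.refl _).prodCongr (pos h).symm)

theorem basisO_zero (i : Idx h) : H.basisO (0, i) = H.basisLattice (pos h i) := by
  simp [basisO, Module.Basis.smulTower_apply, basisOF]

theorem basisO_one (i : Idx h) : H.basisO (1, i) = H.ϖ • H.basisLattice (pos h i) := by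
  simp [basisO, Module.Basis.smulTower_apply, basisOF]

variable (R : Type u) [CommRing R] [Algebra OF R]

/-- The basis of `Λ_m ⊗ R` formed by the generators `f_i` and by the `t f_i`. -/
def basisR : Module.Basis (Fin 2 × Idx h) R (H.LamR R) := (H.basisO.baseChange OF).baseChange R

theorem basisR_apply (p : Fin 2 × Idx h) :
    H.basisR R p = (1 : R) ⊗ₜ[OF] ((1 : OF) ⊗ₜ[O₀] H.basisO p) := by
  simp [basisR]

/-- The coordinates on `Λ_m ⊗ R`. -/
def toCoord : H.LamR R ≃ₗ[R] Coord h R :=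
  (H.basisR R).equivFun ≪≫ₗ shear h (algebraMap OF R H.ϖ)

theorem toCoord_basisR_zero (i : Idx h) :
    H.toCoord R (H.basisR R (0, i)) = (Pi.single i 1, 0) := by
  ext j
  · simp [toCoord, shear, Finsupp.single_apply, Pi.single_apply, eq_comm]
  · simp [toCoord, shear, Finsupp.single_apply]

theorem toCoord_basisR_one (i : Idx h) :
    H.toCoord R (H.basisR R (1, i)) = ((-algebraMap OF R H.ϖ) • Pi.single i 1, Pi.single i 1) := by
  ext j
  · simp only [toCoord, shear, LinearEquiv.trans_apply, LinearEquiv.coe_mk,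
      Module.Basis.equivFun_apply, Module.Basis.repr_self, Finsupp.single_apply, Pi.smul_apply,
      Pi.single_apply, LinearMap.coe_mk, AddHom.coe_mk]
    by_cases hij : i = j <;> simp [hij, eq_comm]
  · simp [toCoord, shear, Finsupp.single_apply, Pi.single_apply, eq_comm]

variable {R}

theorem toCoord_rTensor {R' : Type u} [CommRing R'] [Algebra OF R'] (f : R →ₐ[OF] R')
    (x : H.LamR R) : H.toCoord R' (LinearMap.rTensor H.Lam f.toLinearMap x) =
      mapCoord (f : R →+* R') (H.toCoord R x) := by
  have key : ∀ p, (H.basisR R').repr (LinearMap.rTensor H.Lam f.toLinearMap x) p =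
      f ((H.basisR R).repr x p) := by
    intro p
    induction x using TensorProduct.induction_on with
    | zero => simp
    | tmul r l => simp [basisR, Module.Basis.baseChange_repr_tmul]
    | add x y hx hy => simp [map_add, hx, hy]
  ext i <;> simp [toCoord, shear, mapCoord, key]

theorem toCoord_t (x : H.LamR R) :
    H.toCoord R (H.t.baseChange R x) = tCoord h (algebraMap OF R H.ϖ) (H.toCoord R x) := by
  have : (H.toCoord R).toLinearMap ∘ₗ H.t.baseChange R =
      tCoord h (algebraMap OF R H.ϖ) ∘ₗ (H.toCoord R).toLinearMap := by
    refine (H.basisR R).ext fun ⟨a, i⟩ => ?_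
    have ht : ∀ p, H.t.baseChange R (H.basisR R p) =
        (1 : R) ⊗ₜ[OF] ((1 : OF) ⊗ₜ[O₀] (H.ϖ • H.basisO p)) := fun p => by
      rw [basisR_apply]; rfl
    fin_cases a
    · change H.toCoord R (H.t.baseChange R (H.basisR R (0, i))) =
        tCoord h (algebraMap OF R H.ϖ) (H.toCoord R (H.basisR R (0, i)))
      rw [ht, basisO_zero, ← basisO_one, ← basisR_apply, toCoord_basisR_one, toCoord_basisR_zero]
      simp [tCoord]
    · change H.toCoord R (H.t.baseChange R (H.basisR R (1, i))) =
        tCoord h (algebraMap OF R H.ϖ) (H.toCoord R (H.basisR R (1, i)))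
      have e : (1 : R) ⊗ₜ[OF] ((1 : OF) ⊗ₜ[O₀] (H.ϖ • H.basisO (1, i))) =
          (algebraMap OF R H.ϖ ^ 2) • H.basisR R (0, i) := by
        rw [basisO_one, ← basisO_zero, ← mul_smul, ← sq, H.ϖ_sq, algebraMap_smul, ← map_pow,
          H.ϖ_sq, algebraMap_smul, basisR_apply, ← TensorProduct.tmul_smul,
          algebraMap_smul, TensorProduct.tmul_smul]
      rw [ht, e, map_smul, toCoord_basisR_one, toCoord_basisR_zero]
      ext j
      · simp [tCoord]
        rw [Algebra.smul_def, Algebra.smul_def]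
        ring
      · simp [tCoord]
  exact LinearMap.congr_fun this x

theorem toCoord_form (x y : H.LamR R) :
    (H.form.baseChange R) x y = bil (H.toCoord R x) (H.toCoord R y) := by
  have : H.form.baseChange R = (bilForm h R).compl₁₂ (H.toCoord R).toLinearMap
      (H.toCoord R).toLinearMap := by
    refine LinearMap.BilinForm.ext_basis (H.basisR R) fun ⟨a, i⟩ ⟨b, j⟩ => ?_
    have hf : ∀ p p', H.form.baseChange R (H.basisR R p) (H.basisR R p') =
        algebraMap OF R (algebraMap O₀ OF (H.latticeForm (H.basisO p) (H.basisO p'))) :=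
      fun p p' => by
        rw [basisR_apply, basisR_apply, LinearMap.BilinForm.baseChange_tmul, form,
          LinearMap.BilinForm.baseChange_tmul]
        simp [Algebra.smul_def]
    have hop : ∀ i j : Idx h, pos h i = (pos h j).rev ↔ i = op j := fun i j => by
      rw [← pos_op, (pos h).injective.eq_iff]
    rw [hf]
    change _ = bil (H.toCoord R (H.basisR R (a, i))) (H.toCoord R (H.basisR R (b, j)))
    have key : ∀ i j, H.latticeForm (H.basisO (0, i)) (H.basisO (1, j)) =
        if i = op j then (if (pos h i : ℕ) < h + 1 then -1 else 1) else 0 := fun i j => by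
      rw [basisO_zero, basisO_one, latticeForm_gen_smul, if_congr (hop i j) rfl rfl]
    fin_cases a <;> fin_cases b
    · change algebraMap OF R (algebraMap O₀ OF (H.latticeForm (H.basisO (0, i)) (H.basisO (0, j))))
        = bil (H.toCoord R (H.basisR R (0, i))) (H.toCoord R (H.basisR R (0, j)))
      rw [basisO_zero, basisO_zero, latticeForm_gen_gen, toCoord_basisR_zero, toCoord_basisR_zero]
      simp [bil]
    · change algebraMap OF R (algebraMap O₀ OF (H.latticeForm (H.basisO (0, i)) (H.basisO (1, j))))
        = bil (H.toCoord R (H.basisR R (0, i))) (H.toCoord R (H.basisR R (1, j)))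
      rw [toCoord_basisR_zero, toCoord_basisR_one, key, bil]
      simp only [map_zero, add_zero, sp_single]
      split_ifs <;> simp
    · change algebraMap OF R (algebraMap O₀ OF (H.latticeForm (H.basisO (1, i)) (H.basisO (0, j))))
        = bil (H.toCoord R (H.basisR R (1, i))) (H.toCoord R (H.basisR R (0, j)))
      rw [toCoord_basisR_zero, toCoord_basisR_one, latticeForm_comm, key, bil]
      simp only [map_zero, zero_add, sp_single]
      split_ifs <;> simp
    · change algebraMap OF R (algebraMap O₀ OF (H.latticeForm (H.basisO (1, i)) (H.basisO (1, j))))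
        = bil (H.toCoord R (H.basisR R (1, i))) (H.toCoord R (H.basisR R (1, j)))
      rw [basisO_one, basisO_one, latticeForm_smul_smul, toCoord_basisR_one, toCoord_basisR_one,
        bil]
      simp only [map_smul, LinearMap.smul_apply, smul_eq_mul]
      rw [sp_neg (Pi.single i 1) (Pi.single j 1)]
      simp
  rw [this]; rfl

variable (R) in
/-- The coordinates of the vectors of `Λ' ⊗ R`. -/
theorem mem_lambdaPrimeR (x : H.LamR R) : x ∈ H.lambdaPrimeR R ↔
    (H.toCoord R x).2 (some none) = 0 ∧ (H.toCoord R x).1 (some none) = 0 ∧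
      ∀ k, (H.toCoord R x).1 (some (some k)) =
        -(algebraMap OF R H.ϖ * (H.toCoord R x).2 (some (some k))) := by
  let T : Submodule R (Coord h R) :=
    { carrier := {y | y.2 (some none) = 0 ∧ y.1 (some none) = 0 ∧
        ∀ k, y.1 (some (some k)) = -(algebraMap OF R H.ϖ * y.2 (some (some k)))}
      zero_mem' := by simp
      add_mem' := by
        rintro a b ⟨h1, h2, h3⟩ ⟨h4, h5, h6⟩
        refine ⟨by simp [h1, h4], by simp [h2, h5], fun k => ?_⟩
        simp only [Prod.fst_add, Prod.snd_add, Pi.add_apply, h3, h6]; ring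
      smul_mem' := by
        rintro r a ⟨h1, h2, h3⟩
        refine ⟨by simp [h1], by simp [h2], fun k => ?_⟩
        simp only [Prod.smul_fst, Prod.smul_snd, Pi.smul_apply, h3, smul_eq_mul]; ring }
  have g0 : H.toCoord R ((1 : R) ⊗ₜ[OF] ((1 : OF) ⊗ₜ[O₀] H.basisO (0, none))) ∈ T := by
    rw [← basisR_apply, toCoord_basisR_zero]
    refine ⟨?_, ?_, fun k => ?_⟩ <;> simp
  have g1 : ∀ i, i ≠ some none →
      H.toCoord R ((1 : R) ⊗ₜ[OF] ((1 : OF) ⊗ₜ[O₀] H.basisO (1, i))) ∈ T := by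
    intro i hi
    rw [← basisR_apply, toCoord_basisR_one]
    refine ⟨?_, ?_, fun k => ?_⟩ <;> simp [hi.symm]
  -- the given generators of `Λ'` are, up to sign, the vectors `f_1` and `t f_i`, `i < n`
  have e0 : ((H.basisO (0, none) : H.latticeM) : V) = H.pi⁻¹ • H.e (pos h none) := by
    rw [basisO_zero, coe_basisLattice, gen, if_pos (by simp)]
  have e1 : ∀ i, (pos h i : ℕ) < h + 1 → ((H.basisO (1, i) : H.latticeM) : V) = H.e (pos h i) := by
    intro i hi
    rw [basisO_one, coe_smul_lattice, coe_basisLattice, gen, if_pos hi]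
    exact smul_inv_smul₀ H.pi_ne_zero _
  have e2 : ∀ i, ¬ (pos h i : ℕ) < h + 1 →
      ((H.basisO (1, i) : H.latticeM) : V) = H.pi • H.e (pos h i) := by
    intro i hi
    rw [basisO_one, coe_smul_lattice, coe_basisLattice, gen, if_neg hi]; rfl
  have hlast : ∀ i, (pos h i : ℕ) + 1 < 2 * (h + 1) → i ≠ some none := by
    rintro i hi rfl
    simp only [pos_some_none] at hi
    omega
  constructor
  · intro hx
    change H.toCoord R x ∈ T
    have hle : H.lambdaPrimeR R ≤ T.comap (H.toCoord R).toLinearMap := by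
      refine Submodule.span_le.2 ?_
      rintro _ ⟨v, hv, rfl⟩
      change H.toCoord R _ ∈ T
      have hS : ∀ w ∈ Submodule.span O₀
          ({v : V | ∃ i : Fin (2 * (h + 1)), (i : ℕ) = 0 ∧ v = -(H.pi⁻¹ • H.e i)} ∪
          {v : V | ∃ i : Fin (2 * (h + 1)), (i : ℕ) < h + 1 ∧ v = -H.e i} ∪
          {v : V | ∃ i : Fin (2 * (h + 1)), h + 1 ≤ (i : ℕ) ∧ (i : ℕ) + 1 < 2 * (h + 1) ∧
            v = H.pi • H.e i}), ∃ v : H.latticeM, (v : V) = w ∧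
            H.toCoord R ((1 : R) ⊗ₜ[OF] ((1 : OF) ⊗ₜ[O₀] v)) ∈ T := by
        intro w hw
        induction hw using Submodule.span_induction with
        | zero => exact ⟨0, rfl, by simp⟩
        | add a b _ _ ha hb =>
          obtain ⟨v, rfl, hv⟩ := ha
          obtain ⟨v', rfl, hv'⟩ := hb
          refine ⟨v + v', rfl, ?_⟩
          rw [TensorProduct.tmul_add, TensorProduct.tmul_add, map_add]
          exact T.add_mem hv hv'
        | smul c a _ ha =>
          obtain ⟨v, rfl, hv⟩ := ha
          refine ⟨c • v, rfl, ?_⟩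
          rw [TensorProduct.tmul_smul, ← algebraMap_smul OF c ((1 : OF) ⊗ₜ[O₀] v),
            TensorProduct.tmul_smul, ← algebraMap_smul R (algebraMap O₀ OF c), map_smul]
          exact T.smul_mem _ hv
        | mem w hw =>
          rcases hw with (⟨i, hi, rfl⟩ | ⟨i, hi, rfl⟩) | ⟨i, hi, hi', rfl⟩
          · have : i = pos h none := Fin.ext hi
            refine ⟨-H.basisO (0, none), by rw [Submodule.coe_neg, e0, this], ?_⟩
            rw [TensorProduct.tmul_neg, TensorProduct.tmul_neg, map_neg]
            exact T.neg_mem g0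
          · obtain ⟨i, rfl⟩ := (pos h).surjective i
            refine ⟨-H.basisO (1, i), by rw [Submodule.coe_neg, e1 i hi], ?_⟩
            rw [TensorProduct.tmul_neg, TensorProduct.tmul_neg, map_neg]
            exact T.neg_mem (g1 i (hlast i (by omega)))
          · obtain ⟨i, rfl⟩ := (pos h).surjective i
            exact ⟨H.basisO (1, i), e2 i (by omega), g1 i (hlast i hi')⟩
      obtain ⟨v', hv', h'⟩ := hS v hv
      rwa [← Subtype.ext hv']
    exact hle hx
  · rintro ⟨h1, h2, h3⟩
    set y := H.toCoord R x with hy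
    have hx : x = (H.toCoord R).symm y := by rw [hy, LinearEquiv.symm_apply_apply]
    have m0 : H.basisR R (0, none) ∈ H.lambdaPrimeR R := by
      refine Submodule.subset_span ⟨H.basisO (0, none), ?_, basisR_apply _ _ _⟩
      change ((H.basisO (0, none) : H.latticeM) : V) ∈ Submodule.span O₀ _
      rw [e0, ← neg_neg (H.pi⁻¹ • H.e (pos h none))]
      exact Submodule.neg_mem _ (Submodule.subset_span (Or.inl (Or.inl ⟨_, rfl, rfl⟩)))
    have m1 : ∀ i, i ≠ some none → H.basisR R (1, i) ∈ H.lambdaPrimeR R := by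
      intro i hi
      refine Submodule.subset_span ⟨H.basisO (1, i), ?_, basisR_apply _ _ _⟩
      change ((H.basisO (1, i) : H.latticeM) : V) ∈ Submodule.span O₀ _
      by_cases hlt : (pos h i : ℕ) < h + 1
      · rw [e1 i hlt, ← neg_neg (H.e (pos h i))]
        exact Submodule.neg_mem _ (Submodule.subset_span (Or.inl (Or.inr ⟨_, hlt, rfl⟩)))
      · rw [e2 i hlt]
        refine Submodule.subset_span (Or.inr ⟨_, by omega, ?_, rfl⟩)
        have h4 : (pos h i : ℕ) ≠ 2 * h + 1 := fun h' =>
          hi ((pos h).injective (Fin.ext (h'.trans pos_some_none.symm)))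
        have := (pos h i).isLt
        omega
    have hsum : x = (y.1 none + algebraMap OF R H.ϖ * y.2 none) • H.basisR R (0, none) +
        ∑ i, y.2 i • H.basisR R (1, i) := by
      apply (H.toCoord R).injective
      rw [← hy, map_add, map_sum, map_smul, toCoord_basisR_zero]
      simp only [map_smul, toCoord_basisR_one]
      ext i
      · simp only [Prod.fst_add, Prod.smul_fst, Prod.fst_sum, Pi.add_apply, Finset.sum_apply,
          Pi.smul_apply, smul_eq_mul, Pi.single_apply]
        match i with
        | none => simp; ring
        | some none => simp [h1, h2]
        | some (some k) => simp [h3]; ring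
      · simp only [Prod.snd_add, Prod.smul_snd, smul_zero, zero_add, Prod.snd_sum,
          Finset.sum_apply, Pi.smul_apply, smul_eq_mul, Pi.single_apply, mul_ite, mul_one,
          mul_zero, Finset.sum_ite_eq, Finset.mem_univ, if_true]
    rw [hsum]
    refine Submodule.add_mem _ (Submodule.smul_mem _ _ m0) (Submodule.sum_mem _ fun i _ => ?_)
    by_cases hi : i = some none
    · rw [hi, h1, zero_smul]; exact Submodule.zero_mem _
    · exact Submodule.smul_mem _ _ (m1 i hi)

end SplitHermitian

/-! ### Base change and the universal data -/

namespace ChartCoord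

variable {h q : ℕ} {R : Type u} {R' : Type*} [CommRing R] [CommRing R'] (f : R →+* R')

theorem map_midForm (x y : Fin (2 * h) → R) :
    midForm (fun k => f (x k)) (fun k => f (y k)) = f (midForm x y) := by
  rw [midForm_apply, midForm_apply, map_sum]
  refine Finset.sum_congr rfl fun k _ => ?_
  rw [map_mul, map_mul]
  congr 2
  unfold sgn
  split_ifs <;> simp

theorem map_sp (a c : Idx h → R) : sp (fun i => f (a i)) (fun i => f (c i)) = f (sp a c) := by
  rw [sp_apply, sp_apply, map_add, map_add, map_neg, map_mul, map_mul, ← map_midForm]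

theorem map_bil (x y : Coord h R) : bil (mapCoord f x) (mapCoord f y) = f (bil x y) := by
  rw [bil, bil, map_add, ← map_sp, ← map_sp]; rfl

/-- The conditions on the points `(ℱ₀, ℱ₁)` of the splitting model, apart from those on ranks, in
coordinates. -/
structure IsFlag (ϖ : R) (N₀ N₁ : Submodule R (Coord h R)) : Prop where
  fst_zero : ∀ x ∈ N₀, x.1 = 0
  le : N₀ ≤ N₁
  iso : ∀ x ∈ N₁, ∀ y ∈ N₁, bil x y = 0
  add_mem : ∀ x ∈ N₁, ((0, x.1 + (2 * ϖ) • x.2) : Coord h R) ∈ N₀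

variable {f}

theorem IsFlag.span {ϖ : R} {N₀ N₁ : Submodule R (Coord h R)} (hN : IsFlag ϖ N₀ N₁) :
    IsFlag (f ϖ) (Submodule.span R' (mapCoord f '' (N₀ : Set (Coord h R))))
      (Submodule.span R' (mapCoord f '' (N₁ : Set (Coord h R)))) where
  fst_zero x hx := by
    induction hx using Submodule.span_induction with
    | mem x hx =>
      obtain ⟨y, hy, rfl⟩ := hx
      funext i
      simp [mapCoord, hN.fst_zero y hy]
    | zero => rfl
    | add x y _ _ h h' => rw [Prod.fst_add, h, h', add_zero]
    | smul r x _ h => rw [Prod.smul_fst, h, smul_zero]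
  le := Submodule.span_mono (Set.image_mono hN.le)
  iso x hx y hy := by
    change bilForm h R' x y = 0
    induction hx using Submodule.span_induction with
    | zero => simp
    | add x x' _ _ h h' => rw [map_add, LinearMap.add_apply, h, h', add_zero]
    | smul r x _ h => rw [map_smul, LinearMap.smul_apply, h, smul_zero]
    | mem x hx =>
      induction hy using Submodule.span_induction with
      | zero => simp
      | add x x' _ _ h h' => rw [map_add, h, h', add_zero]
      | smul r x _ h => rw [map_smul, h, smul_zero]
      | mem y hy =>
        obtain ⟨x, hx, rfl⟩ := hx
        obtain ⟨y, hy, rfl⟩ := hy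
        exact (map_bil f x y).trans (by rw [hN.iso x hx y hy, map_zero])
  add_mem x hx := by
    induction hx using Submodule.span_induction with
    | mem x hx =>
      obtain ⟨y, hy, rfl⟩ := hx
      refine Submodule.subset_span ⟨_, hN.add_mem y hy, ?_⟩
      ext i <;> simp [mapCoord, map_ofNat f 2]
    | zero =>
      convert Submodule.zero_mem _ using 1
      ext i <;> simp
    | add x y _ _ h h' =>
      convert Submodule.add_mem _ h h' using 1
      ext i
      · simp
      · simp; ring
    | smul r x _ h =>
      convert Submodule.smul_mem _ r h using 1
      ext i
      · simp
      · simp; ring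

namespace Data

/-- Base change of the coordinates of a chart. -/
@[simps] def map (f : R →+* R') (z : Data h q R) : Data h q R' where
  w := f z.w
  d k := f (z.d k)
  D := Matrix.of fun p p' => f (z.D p p')
  M := Matrix.of fun k j => f (z.M k j)

theorem map_omega (z : Data h q R) (i j : Fin (q + 1)) :
    (z.map f).omega i j = f (z.omega i j) := by
  rw [omega, omega, ← map_midForm]; rfl

theorem map_col (z : Data h q R) (j : Fin (q + 1)) :
    (z.map f).col j = fun i => f (z.col j i) := by
  funext i
  match i with
  | none =>
    refine Fin.cases ?_ (fun p => ?_) j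
    · exact (map_one f).symm
    · exact (map_zero f).symm
  | some none =>
    refine Fin.cases rfl (fun p => ?_) j
    simp [map_omega]
  | some (some k) => rfl

theorem map_comb (z : Data h q R) (v : Fin (q + 1) → R) :
    (z.map f).comb (fun j => f (v j)) = fun i => f (z.comb v i) := by
  funext i
  simp [comb_apply, map_col, Finset.sum_apply]

variable {ϖ : R} {rows : Fin q ↪ Fin (2 * h)} {z : Data h q R}

theorem Valid.map (hz : z.Valid ϖ rows) : (z.map f).Valid (f ϖ) rows where
  M_rows p j := by simp [hz.M_rows, apply_ite f]
  D_skew p p' := by simp [hz.D_skew p p']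
  D_omega p p' := by
    simp only [map_omega, map_D, Matrix.of_apply, ← map_mul, ← map_sum, hz.D_omega, apply_ite f,
      map_zero]
    rw [map_mul, map_ofNat]

theorem proj0_mapCoord (x : Coord h R) (j) :
    proj0 R' rows (mapCoord f x) j = f (proj0 R rows x j) := rfl

theorem proj1_mapCoord (x : Coord h R) (i) : proj1 R' (mapCoord f x) i = f (proj1 R x i) := by
  match i with
  | none => rfl
  | some none => rfl
  | some (some k) => rfl

theorem Valid.span_fil0 (hz : z.Valid ϖ rows) :
    Submodule.span R' (mapCoord f '' (z.fil0 : Set (Coord h R))) = (z.map f).fil0 := by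
  refine eq_of_le_of_map_eq_top (proj0 R' rows) (Submodule.span_le.2 ?_)
    (map_span_eq_top f _ (proj0 R rows) _ proj0_mapCoord hz.map_proj0_fil0)
    fun x hx h0 => hz.map.eq_zero_of_proj0 hx h0
  rintro _ ⟨x, hx, rfl⟩
  obtain ⟨v, rfl⟩ := mem_fil0.1 hx
  refine mem_fil0.2 ⟨fun j => f (v j), ?_⟩
  rw [map_comb]
  ext i <;> simp [mapCoord]

theorem Valid.span_fil1 (hz : z.Valid ϖ rows) :
    Submodule.span R' (mapCoord f '' (z.fil1 ϖ : Set (Coord h R))) = (z.map f).fil1 (f ϖ) := by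
  refine eq_of_le_of_map_eq_top (proj1 R') (Submodule.span_le.2 ?_)
    (map_span_eq_top f _ (proj1 R) _ proj1_mapCoord hz.map_proj1_fil1)
    fun x hx h0 => eq_zero_of_proj1_eq_zero hz.map.map_proj1_fil1
      (fun y hy => hz.map.bil_eq_zero hx hy) h0
  rintro _ ⟨x, hx, rfl⟩
  obtain ⟨ψ, h1, h2, h3⟩ := mem_fil1.1 hx
  have hsp : ∀ j, sp ((z.map f).col j) (mapCoord f x).2 = f (sp (z.col j) x.2) := fun j => by
    rw [map_col, ← map_sp]; rfl
  refine mem_fil1.2 ⟨fun j => f (ψ j), ?_, ?_, fun k => ?_⟩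
  · rw [map_comb, ← h1]
    funext i
    simp [mapCoord, map_ofNat f 2]
  · simp only [hsp, h2, map_sum, map_mul]
    rfl
  · simp only [hsp, h3, map_sum, map_mul, map_add, map_neg]
    rfl

theorem Valid.isFlag (h2 : IsUnit (2 : R)) (hz : z.Valid ϖ rows) : IsFlag ϖ z.fil0 (z.fil1 ϖ) where
  fst_zero _ hx := fst_of_mem_fil0 hx
  le := hz.fil0_le_fil1 h2
  iso _ hx _ hy := hz.bil_eq_zero hx hy
  add_mem _ hx := add_mem_fil0 hx

end Data

section equations

variable {A : Type u} [CommRing A] {S : Type u} [CommRing S] [Algebra A S]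

/-- The evaluation of the variables `D` and `M₂` at the coordinates of a chart. -/
def Data.eval (A : Type u) [CommRing A] [Algebra A S] (z : Data h q S) :
    MvPolynomial (ChartEquations.Vars h q) A →ₐ[A] S :=
  MvPolynomial.aeval (Sum.elim (fun p => z.D p.1 p.2) (fun p => z.M p.1 p.2))

theorem Data.eval_matD (z : Data h q S) (p p') :
    z.eval A (ChartEquations.matD A h q p p') = z.D p p' := by
  simp [Data.eval, ChartEquations.matD]

theorem Data.eval_matM (z : Data h q S) (k j) :
    z.eval A (ChartEquations.matM A h q k j) = z.M k j := by
  simp [Data.eval, ChartEquations.matM]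

theorem Data.eval_matQ (z : Data h q S) (i j) :
    z.eval A (ChartEquations.matQ A h q i j) = -z.omega i.succ j.succ := by
  rw [Data.omega, midForm_eq_sum_half, neg_neg, ChartEquations.matQ, Matrix.of_apply, map_sum]
  refine Finset.sum_congr rfl fun k _ => ?_
  simp only [map_sub, map_mul, Data.eval_matM]

/-- The equations of the charts are the defining relations of the ring `A[D, M₂] / I`. -/
theorem Data.valid_iff (ϖ : A) (rows : Fin q ↪ Fin (2 * h)) (z : Data h q S) :
    z.Valid (algebraMap A S ϖ) rows ↔
      ∀ x ∈ ChartEquations.ideal A h q ϖ rows, z.eval A x = 0 := by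
  have e1 : ∀ p j, z.eval A (((ChartEquations.matM A h q).submatrix rows id -
      ChartEquations.zeroOne A h q) p j) = z.M (rows p) j - if j = p.succ then 1 else 0 := by
    intro p j
    rw [Matrix.sub_apply, Matrix.submatrix_apply, map_sub, id, Data.eval_matM,
      ChartEquations.zeroOne, Matrix.of_apply, apply_ite (z.eval A), map_one, map_zero]
  have e2 : ∀ p p', z.eval A ((ChartEquations.matD A h q +
      (ChartEquations.matD A h q).transpose) p p') = z.D p p' + z.D p' p := by
    intro p p'
    rw [Matrix.add_apply, Matrix.transpose_apply, map_add, Data.eval_matD, Data.eval_matD]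
  have e3 : ∀ p p', z.eval A ((ChartEquations.matD A h q * ChartEquations.matQ A h q +
      (2 * MvPolynomial.C ϖ : MvPolynomial (ChartEquations.Vars h q) A) •
        (1 : Matrix (Fin q) (Fin q) (MvPolynomial (ChartEquations.Vars h q) A))) p p') =
      -∑ k, z.D p k * z.omega k.succ p'.succ + if p = p' then 2 * algebraMap A S ϖ else 0 := by
    intro p p'
    rw [Matrix.add_apply, Matrix.mul_apply, map_add, map_sum, Matrix.smul_apply, Matrix.one_apply,
      ← Finset.sum_neg_distrib]
    congr 1
    · refine Finset.sum_congr rfl fun k _ => ?_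
      rw [map_mul, Data.eval_matD, Data.eval_matQ, mul_neg]
    · rw [smul_eq_mul, map_mul, map_mul, map_ofNat, apply_ite (z.eval A), map_one, map_zero,
        mul_ite, mul_one, mul_zero]
      congr 2
      exact (z.eval A).commutes ϖ
  constructor
  · intro hz x hx
    have hle : ChartEquations.ideal A h q ϖ rows ≤ RingHom.ker (z.eval A) := by
      refine Ideal.span_le.2 ?_
      rintro _ ((⟨⟨p, j⟩, rfl⟩ | ⟨⟨p, p'⟩, rfl⟩) | ⟨⟨p, p'⟩, rfl⟩)
      · exact (e1 p j).trans (by rw [hz.M_rows, sub_self])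
      · exact (e2 p p').trans (by rw [hz.D_skew p p']; ring)
      · exact (e3 p p').trans (by rw [hz.D_omega]; ring)
    exact hle hx
  · intro hx
    refine ⟨fun p j => ?_, fun p p' => ?_, fun p p' => ?_⟩
    · have := hx _ (Ideal.subset_span (Or.inl (Or.inl ⟨(p, j), rfl⟩)))
      exact sub_eq_zero.1 ((e1 p j).symm.trans this)
    · have := hx _ (Ideal.subset_span (Or.inl (Or.inr ⟨(p, p'), rfl⟩)))
      exact (neg_eq_of_add_eq_zero_right ((e2 p p').symm.trans this)).symm
    · have := hx _ (Ideal.subset_span (Or.inr ⟨(p, p'), rfl⟩))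
      exact neg_add_eq_zero.1 ((e3 p p').symm.trans this)

/-- The ring of functions `A[w, d] ⊗ A[D, M₂] / I` on a chart. -/
abbrev ChartRing {A : Type u} [CommRing A] (ϖ : A) (rows : Fin q ↪ Fin (2 * h)) : Type u :=
  MvPolynomial (Fin (q + 1)) A ⊗[A] ChartEquations.Ring A h q ϖ rows

/-- The universal coordinates. -/
def univData (ϖ : A) (rows : Fin q ↪ Fin (2 * h)) : Data h q (ChartRing ϖ rows) where
  w := MvPolynomial.X 0 ⊗ₜ 1
  d k := MvPolynomial.X k.succ ⊗ₜ 1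
  D := Matrix.of fun p p' => 1 ⊗ₜ Ideal.Quotient.mk _ (MvPolynomial.X (Sum.inl (p, p')))
  M := Matrix.of fun k j => 1 ⊗ₜ Ideal.Quotient.mk _ (MvPolynomial.X (Sum.inr (k, j)))

/-- `z` is the universal solution of the equations of a chart. -/
structure IsUniversal {B : Type u} [CommRing B] [Algebra A B] (ϖ : A) (rows : Fin q ↪ Fin (2 * h))
    (z : Data h q B) : Prop where
  valid : z.Valid (algebraMap A B ϖ) rows
  exists_map : ∀ {S : Type u} [CommRing S] [Algebra A S] (y : Data h q S),
    y.Valid (algebraMap A S ϖ) rows → ∃ g : B →ₐ[A] S, z.map g.toRingHom = y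
  injective : ∀ {S : Type u} [CommRing S] [Algebra A S] (g g' : B →ₐ[A] S),
    z.map g.toRingHom = z.map g'.toRingHom → g = g'

theorem univData_isUniversal (ϖ : A) (rows : Fin q ↪ Fin (2 * h)) :
    IsUniversal ϖ rows (univData ϖ rows) where
  valid := by
    refine (Data.valid_iff (S := ChartRing ϖ rows) ϖ rows _).2 ?_
    intro x hx
    have : (univData ϖ rows).eval A = (Algebra.TensorProduct.includeRight :
        ChartEquations.Ring A h q ϖ rows →ₐ[A] ChartRing ϖ rows).comp
        (Ideal.Quotient.mkₐ A (ChartEquations.ideal A h q ϖ rows)) := by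
      refine MvPolynomial.algHom_ext fun i => ?_
      rcases i with ⟨p, p'⟩ | ⟨k, j⟩ <;> simp [Data.eval, univData]
    rw [this]
    change Algebra.TensorProduct.includeRight (Ideal.Quotient.mk _ x) = 0
    rw [Ideal.Quotient.eq_zero_iff_mem.2 hx, map_zero]
  exists_map {S} _ _ z hz := by
    let g1 : MvPolynomial (Fin (q + 1)) A →ₐ[A] S := MvPolynomial.aeval (Fin.cons z.w z.d)
    let g2 : ChartEquations.Ring A h q ϖ rows →ₐ[A] S :=
      Ideal.Quotient.liftₐ _ (z.eval A) ((Data.valid_iff ϖ rows z).1 hz)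
    have h2 : ∀ x, g2 (Ideal.Quotient.mk _ x) = z.eval A x := fun x => rfl
    have hc : ∀ x y, Commute (g1 x) (g2 y) := fun _ _ => Commute.all _ _
    refine ⟨Algebra.TensorProduct.lift g1 g2 hc, ?_⟩
    refine Data.ext ?_ (funext fun k => ?_) (Matrix.ext fun p p' => ?_) (Matrix.ext fun k j => ?_)
    · change Algebra.TensorProduct.lift g1 g2 hc (MvPolynomial.X 0 ⊗ₜ 1) = _
      rw [Algebra.TensorProduct.lift_tmul, map_one, mul_one]
      simp [g1]
    · change Algebra.TensorProduct.lift g1 g2 hc (MvPolynomial.X k.succ ⊗ₜ 1) = _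
      rw [Algebra.TensorProduct.lift_tmul, map_one, mul_one]
      simp [g1]
    · change Algebra.TensorProduct.lift g1 g2 hc (1 ⊗ₜ Ideal.Quotient.mk _ _) = _
      rw [Algebra.TensorProduct.lift_tmul, map_one, one_mul, h2]
      simp [Data.eval]
    · change Algebra.TensorProduct.lift g1 g2 hc (1 ⊗ₜ Ideal.Quotient.mk _ _) = _
      rw [Algebra.TensorProduct.lift_tmul, map_one, one_mul, h2]
      simp [Data.eval]
  injective g g' h := by
    refine Algebra.TensorProduct.ext (MvPolynomial.algHom_ext fun i => ?_)
      (Ideal.Quotient.algHom_ext _ (MvPolynomial.algHom_ext fun i => ?_))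
    · refine Fin.cases ?_ (fun k => ?_) i
      · exact congrArg Data.w h
      · exact congrFun (congrArg Data.d h) k
    · rcases i with ⟨p, p'⟩ | ⟨k, j⟩
      · exact congrFun (congrFun (congrArg Data.D h) p) p'
      · exact congrFun (congrFun (congrArg Data.M h) k) j

end equations

end ChartCoord

/-! ### Charts of the splitting model -/

namespace ChartCoord

/-- Over a field, let `N₁` be given by the equations of `Λ'` at `π = 0`. Then `(t + π) N₁ ⊆ N₀ ⊆ N₁`
shows that the first coordinate is not zero on `N₀` and that `N₀` embeds by its first and its middle
coordinates, so that the first and some `q` middle coordinates form a system of coordinates. -/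
theorem exists_rows_of_isFlag {κ : Type*} [Field κ] {h q : ℕ} {ϖ : κ}
    {N₀ N₁ : Submodule κ (Coord h κ)} (hflag : IsFlag ϖ N₀ N₁)
    (hmem : ∀ x : Coord h κ, x ∈ N₁ ↔ x.2 (some none) = 0 ∧ x.1 (some none) = 0 ∧
      ∀ k, x.1 (some (some k)) = 0) (hfr : Module.finrank κ N₀ = q + 1) :
    ∃ rows : Fin q ↪ Fin (2 * h), N₀.map (proj0 κ rows) = ⊤ ∧
      (∀ x ∈ N₀, proj0 κ rows x = 0 → x = 0) ∧ N₁.map (proj1 κ) = ⊤ := by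
  have he : ((0, Pi.single none 1) : Coord h κ) ∈ N₀ := by
    have hx : ((Pi.single none 1, 0) : Coord h κ) ∈ N₁ := (hmem _).2 (by simp)
    have := hflag.add_mem _ hx
    simpa using this
  let ev : Idx h → N₀ →ₗ[κ] κ := fun i => LinearMap.proj i ∘ₗ LinearMap.snd κ _ _ ∘ₗ N₀.subtype
  have hev : ∀ x : N₀, ev none x = 0 → (∀ k, ev (some (some k)) x = 0) → x = 0 := by
    intro x h2 h3
    refine Subtype.ext (Prod.ext (hflag.fst_zero _ x.2) (funext fun i => ?_))
    rcases i with _ | _ | k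
    · exact h2
    · exact ((hmem _).1 (hflag.le x.2)).1
    · exact h3 k
  have hne : ev none ≠ 0 := fun h => by simpa [ev] using LinearMap.congr_fun h ⟨_, he⟩
  have hrows : ∃ rows : Fin q ↪ Fin (2 * h), ∀ x : N₀, ev none x = 0 →
      (∀ p, ev (some (some (rows p))) x = 0) → x = 0 :=
    exists_embedding_injective_ker hfr (ev none) hne (fun k => ev (some (some k))) hev
  obtain ⟨rows, hrows⟩ := hrows
  have hinj : ∀ x ∈ N₀, proj0 κ rows x = 0 → x = 0 := by
    intro x hx h2
    have h3 : ev none ⟨x, hx⟩ = 0 := congrFun h2 0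
    exact congrArg Subtype.val (hrows ⟨x, hx⟩ h3 fun k => congrFun h2 k.succ)
  refine ⟨rows, ?_, hinj, ?_⟩
  · have hs : Function.Surjective ((proj0 κ rows).domRestrict N₀) :=
      (LinearMap.injective_iff_surjective_of_finrank_eq_finrank (by rw [hfr]; simp)).1
        ((injective_iff_map_eq_zero _).2 fun x hx => Subtype.ext (hinj x.1 x.2 hx))
    rw [eq_top_iff]
    intro v _
    obtain ⟨x, hx⟩ := hs v
    exact ⟨x, x.2, hx⟩
  · rw [eq_top_iff]
    intro v _
    refine ⟨(Pi.single none (v (some none)), Function.update v (some none) 0), (hmem _).2 ?_, ?_⟩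
    · simp
    · funext i
      rcases i with _ | _ | k <;> simp

end ChartCoord

namespace SplitHermitian

open ChartCoord

variable {O₀ F₀ OF F V : Type u}
  [CommRing O₀] [IsDomain O₀] [IsDiscreteValuationRing O₀]
  [Field F₀] [Algebra O₀ F₀] [IsFractionRing O₀ F₀]
  [Field F] [Algebra F₀ F] [Algebra O₀ F] [IsScalarTower O₀ F₀ F]
  [CommRing OF] [Algebra O₀ OF] [Algebra OF F] [IsScalarTower O₀ OF F] [IsIntegralClosure OF O₀ F]
  [AddCommGroup V] [Module F V] [Module OF V] [IsScalarTower OF F V]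
  [Module O₀ V] [IsScalarTower O₀ OF V] {h q : ℕ} {H : SplitHermitian O₀ F₀ OF F V (h + 1)}
  {R : Type u} [CommRing R] [Algebra OF R]

theorem isUnit_two_of_algebra (H : SplitHermitian O₀ F₀ OF F V (h + 1)) (R : Type u) [CommRing R]
    [Algebra OF R] : IsUnit (2 : R) := by
  have := (H.isUnit_two.map (algebraMap O₀ OF)).map (algebraMap OF R)
  rwa [map_ofNat, map_ofNat] at this

/-- `(t + π)(a, c) = (0, a + 2πc)` in coordinates. -/
theorem toCoord_t_add (x : H.LamR R) :
    H.toCoord R (H.t.baseChange R x + algebraMap OF R H.ϖ • x) =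
      (0, (H.toCoord R x).1 + (2 * algebraMap OF R H.ϖ) • (H.toCoord R x).2) := by
  rw [map_add, map_smul, toCoord_t]
  ext i
  · simp [tCoord, -algebraMap_smul]
  · simp [tCoord, -algebraMap_smul]
    ring

/-- `(t - π)(a, c) = (-2πa, a)` in coordinates. -/
theorem toCoord_t_sub (x : H.LamR R) :
    H.toCoord R (H.t.baseChange R x - algebraMap OF R H.ϖ • x) =
      (-(2 * algebraMap OF R H.ϖ) • (H.toCoord R x).1, (H.toCoord R x).1) := by
  rw [map_sub, map_smul, toCoord_t]
  ext i
  · simp [tCoord, -algebraMap_smul]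
    ring
  · simp [tCoord, -algebraMap_smul]

namespace Pair

/-- The submodule `ℱ₀` in coordinates. -/
def coord0 (p : H.Pair R) : Submodule R (Coord h R) := p.fil0.map (H.toCoord R).toLinearMap

/-- The submodule `ℱ₁` in coordinates. -/
def coord1 (p : H.Pair R) : Submodule R (Coord h R) := p.fil1.map (H.toCoord R).toLinearMap

theorem mem_coord0 {p : H.Pair R} {x : Coord h R} :
    x ∈ p.coord0 ↔ (H.toCoord R).symm x ∈ p.fil0 :=
  Submodule.mem_map_equiv _

theorem mem_coord1 {p : H.Pair R} {x : Coord h R} :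
    x ∈ p.coord1 ↔ (H.toCoord R).symm x ∈ p.fil1 :=
  Submodule.mem_map_equiv _

theorem toCoord_mem_coord0 {p : H.Pair R} {x : H.LamR R} :
    H.toCoord R x ∈ p.coord0 ↔ x ∈ p.fil0 := by
  rw [mem_coord0, LinearEquiv.symm_apply_apply]

theorem toCoord_mem_coord1 {p : H.Pair R} {x : H.LamR R} :
    H.toCoord R x ∈ p.coord1 ↔ x ∈ p.fil1 := by
  rw [mem_coord1, LinearEquiv.symm_apply_apply]

theorem ext_coord {p p' : H.Pair R} (h0 : p.coord0 = p'.coord0) (h1 : p.coord1 = p'.coord1) :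
    p = p' := by
  ext x
  · rw [← toCoord_mem_coord0, h0, toCoord_mem_coord0]
  · rw [← toCoord_mem_coord1, h1, toCoord_mem_coord1]

theorem map_span_image {R' : Type u} [CommRing R'] [Algebra OF R'] (f : R →ₐ[OF] R')
    (N : Submodule R (H.LamR R)) :
    (Submodule.span R' (LinearMap.rTensor H.Lam f.toLinearMap '' (N : Set (H.LamR R)))).map
        (H.toCoord R').toLinearMap =
      Submodule.span R' (mapCoord f.toRingHom ''
        (N.map (H.toCoord R).toLinearMap : Set (Coord h R))) := by
  rw [Submodule.map_span, ← Set.image_comp, Submodule.map_coe, ← Set.image_comp]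
  congr 1
  exact Set.image_congr fun x _ => H.toCoord_rTensor f x

theorem coord0_map {R' : Type u} [CommRing R'] [Algebra OF R'] (f : R →ₐ[OF] R') (p : H.Pair R) :
    (p.map f).coord0 =
      Submodule.span R' (mapCoord f.toRingHom '' (p.coord0 : Set (Coord h R))) :=
  map_span_image f p.fil0

theorem coord1_map {R' : Type u} [CommRing R'] [Algebra OF R'] (f : R →ₐ[OF] R') (p : H.Pair R) :
    (p.map f).coord1 =
      Submodule.span R' (mapCoord f.toRingHom '' (p.coord1 : Set (Coord h R))) :=
  map_span_image f p.fil1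

variable (H) in
/-- The pair of submodules with given coordinates in a chart. -/
def ofData (z : Data h q R) : H.Pair R where
  fil0 := z.fil0.comap (H.toCoord R).toLinearMap
  fil1 := (z.fil1 (algebraMap OF R H.ϖ)).comap (H.toCoord R).toLinearMap

theorem coord0_ofData (z : Data h q R) : (ofData H z).coord0 = z.fil0 :=
  Submodule.map_comap_eq_of_surjective (H.toCoord R).surjective _

theorem coord1_ofData (z : Data h q R) :
    (ofData H z).coord1 = z.fil1 (algebraMap OF R H.ϖ) :=
  Submodule.map_comap_eq_of_surjective (H.toCoord R).surjective _

theorem ofData_map {R' : Type u} [CommRing R'] [Algebra OF R'] (f : R →ₐ[OF] R')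
    {rows : Fin q ↪ Fin (2 * h)} {z : Data h q R} (hz : z.Valid (algebraMap OF R H.ϖ) rows) :
    (ofData H z).map f = ofData H (z.map f.toRingHom) := by
  refine ext_coord ?_ ?_
  · rw [coord0_map, coord0_ofData, coord0_ofData, hz.span_fil0]
  · rw [coord1_map, coord1_ofData, coord1_ofData, hz.span_fil1]
    congr 1
    exact f.commutes _

/-- The conditions defining the splitting model, in coordinates. -/
theorem IsPoint.isFlag {s : ℕ} {p : H.Pair R} (hp : p.IsPoint s) :
    IsFlag (algebraMap OF R H.ϖ) p.coord0 p.coord1 where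
  fst_zero x hx := by
    have := hp.sub_eq_zero _ (mem_coord0.1 hx)
    have h1 := congrArg (fun y => (H.toCoord R y).2) this
    simp only [toCoord_t_sub, LinearEquiv.apply_symm_apply, map_zero] at h1
    exact h1
  le := Submodule.map_mono hp.le
  iso x hx y hy := by
    rw [mem_coord1] at hx hy
    rw [hp.perp, LinearMap.BilinForm.mem_orthogonal_iff] at hy
    have : (H.form.baseChange R) _ _ = 0 := hy _ hx
    rw [toCoord_form] at this
    simpa using this
  add_mem x hx := by
    have := hp.add_mem _ (mem_coord1.1 hx)
    rwa [← toCoord_mem_coord0, toCoord_t_add, LinearEquiv.apply_symm_apply] at this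

/-- The pairs given by the equations of a chart are points of the splitting model. -/
theorem isPoint_ofData {rows : Fin q ↪ Fin (2 * h)} {z : Data h q R}
    (hz : z.Valid (algebraMap OF R H.ϖ) rows) : (ofData H z).IsPoint (q + 1) := by
  have hflag := hz.isFlag (H.isUnit_two_of_algebra R)
  refine ⟨?_, ?_, ?_, ?_, ?_, ?_⟩
  · have := isSummandOfRank_of_map_eq_top (N := (ofData H z).fil0)
      (proj0 R rows ∘ₗ (H.toCoord R).toLinearMap)
      (by rw [Submodule.map_comp]; exact (congrArg _ (coord0_ofData z)).trans hz.map_proj0_fil0)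
      fun x hx h0 => (H.toCoord R).map_eq_zero_iff.1 (hz.eq_zero_of_proj0 hx h0)
    rwa [Fintype.card_fin] at this
  · have := isSummandOfRank_of_map_eq_top (N := (ofData H z).fil1)
      (proj1 R ∘ₗ (H.toCoord R).toLinearMap)
      (by rw [Submodule.map_comp]; exact (congrArg _ (coord1_ofData z)).trans hz.map_proj1_fil1)
      fun x hx h0 => (H.toCoord R).map_eq_zero_iff.1
        (eq_zero_of_proj1_eq_zero hz.map_proj1_fil1 (fun y hy => hz.bil_eq_zero hx hy) h0)
    have hcard : Fintype.card (Idx h) = 2 * (h + 1) := by simp; ring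
    rwa [hcard] at this
  · exact Submodule.comap_mono hflag.le
  · ext x
    rw [LinearMap.BilinForm.mem_orthogonal_iff]
    constructor
    · intro hx y hy
      change (H.form.baseChange R) y x = 0
      rw [toCoord_form]
      exact hflag.iso _ hy _ hx
    · intro hx
      refine hz.mem_fil1_of_bil (x := H.toCoord R x) fun y hy => ?_
      have : (H.form.baseChange R) ((H.toCoord R).symm y) x = 0 :=
        hx _ (by simpa [ofData] using hy)
      rw [toCoord_form, LinearEquiv.apply_symm_apply] at this
      rwa [bil_comm]
  · intro x hx
    change H.toCoord R _ ∈ z.fil0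
    rw [toCoord_t_add]
    exact hflag.add_mem _ hx
  · intro x hx
    apply (H.toCoord R).injective
    have h1 : (H.toCoord R x).1 = 0 := hflag.fst_zero _ hx
    rw [toCoord_t_sub, h1, smul_zero, map_zero]
    rfl

section chart

variable {B : Type u} [CommRing B] [Algebra OF B] {rows : Fin q ↪ Fin (2 * h)} {z : Data h q B}

theorem inChart_ofData_iff (hz : IsUniversal H.ϖ rows z) (p : H.Pair R) :
    (ofData H z).InChart p ↔
      ∃ y : Data h q R, y.Valid (algebraMap OF R H.ϖ) rows ∧ p = ofData H y := by
  constructor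
  · rintro ⟨g, rfl⟩
    refine ⟨z.map g.toRingHom, ?_, ofData_map g hz.valid⟩
    have := hz.valid.map (f := g.toRingHom)
    rwa [show g.toRingHom (algebraMap OF B H.ϖ) = algebraMap OF R H.ϖ from g.commutes _] at this
  · rintro ⟨y, hy, rfl⟩
    obtain ⟨g, rfl⟩ := hz.exists_map y hy
    exact ⟨g, (ofData_map g hz.valid).symm⟩

theorem inChart_of_map_eq_top (hz : IsUniversal H.ϖ rows z) {p : H.Pair R}
    (hp : IsFlag (algebraMap OF R H.ϖ) p.coord0 p.coord1)
    (top0 : p.coord0.map (proj0 R rows) = ⊤)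
    (inj0 : ∀ x ∈ p.coord0, proj0 R rows x = 0 → x = 0)
    (top1 : p.coord1.map (proj1 R) = ⊤) : (ofData H z).InChart p := by
  rw [inChart_ofData_iff hz]
  obtain ⟨y, hy, h0, h1⟩ := exists_data _ (H.isUnit_two_of_algebra R) rows hp.fst_zero hp.le hp.iso
    hp.add_mem top0 inj0 top1
  exact ⟨y, hy, ext_coord (by rw [coord0_ofData, h0]) (by rw [coord1_ofData, h1])⟩

/-- A chart consists of the pairs in general position with respect to `proj0` and `proj1`. -/
theorem inChart_map_iff (hz : IsUniversal H.ϖ rows z) {p : H.Pair R} (hp : p.IsPoint (q + 1))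
    {R' : Type u} [CommRing R'] [Algebra OF R'] (f : R →ₐ[OF] R') :
    (ofData H z).InChart (p.map f) ↔
      (p.map f).coord0.map (proj0 R' rows) = ⊤ ∧ (p.map f).coord1.map (proj1 R') = ⊤ := by
  constructor
  · rw [inChart_ofData_iff hz]
    rintro ⟨y, hy, e⟩
    rw [e, coord0_ofData, coord1_ofData]
    exact ⟨hy.map_proj0_fil0, hy.map_proj1_fil1⟩
  · rintro ⟨top0, top1⟩
    refine inChart_of_map_eq_top hz ?_ top0 ?_ top1
    · have := hp.isFlag.span (f := f.toRingHom)
      rw [← coord0_map, ← coord1_map] at this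
      rwa [show f.toRingHom (algebraMap OF R H.ϖ) = algebraMap OF R' H.ϖ from f.commutes _] at this
    · let _ : Algebra R R' := f.toRingHom.toAlgebra
      have : Module.Finite R (H.LamR R) := Module.Finite.of_basis (H.basisR R)
      have : Module.Free R (H.LamR R) := Module.Free.of_basis (H.basisR R)
      let φ : H.LamR R →ₗ[R] Coord h R' :=
        { toFun := fun x => mapCoord f.toRingHom (H.toCoord R x)
          map_add' := fun x y => by
            ext i <;> simp [mapCoord]
          map_smul' := fun r x => by
            ext i <;> simp [mapCoord, Algebra.smul_def] <;> rfl }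
      have hφ : Submodule.span R' (φ '' (p.fil0 : Set (H.LamR R))) = (p.map f).coord0 := by
        rw [coord0_map, coord0, Submodule.map_coe, ← Set.image_comp]; rfl
      have key := eq_zero_of_map_span_eq_top (J := Fin (q + 1)) (N := p.fil0)
        (by rw [Fintype.card_fin]; exact hp.rank0) φ (proj0 R' rows) (by rw [hφ, top0])
      rw [hφ] at key
      exact key

/-- The chart is the locus where two determinantal ideals are trivial. -/
theorem ofData_isOpenChart (hz : IsUniversal H.ϖ rows z) : (ofData H z).IsOpenChart (q + 1) where
  isPoint := isPoint_ofData hz.valid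
  injective R _ _ g g' hgg' := by
    have hv : ∀ g : B →ₐ[OF] R, (z.map g.toRingHom).Valid (algebraMap OF R H.ϖ) rows := fun g => by
      have := hz.valid.map (f := g.toRingHom)
      rwa [show g.toRingHom (algebraMap OF B H.ϖ) = algebraMap OF R H.ϖ from g.commutes _] at this
    have e : ofData H (z.map g.toRingHom) = ofData H (z.map g'.toRingHom) := by
      rw [← ofData_map g hz.valid, ← ofData_map g' hz.valid]
      exact hgg'
    refine hz.injective g g' ((hv g).ext (hv g') ?_ ?_)
    · rw [← coord0_ofData (H := H), e, coord0_ofData]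
    · rw [← coord1_ofData, e, coord1_ofData]
  isOpen R _ _ p hp := by
    refine ⟨detIdeal (proj0 R rows) p.coord0 * detIdeal (proj1 R) p.coord1, fun R' _ _ f => ?_⟩
    rw [inChart_map_iff hz hp, coord0_map, coord1_map,
      map_span_eq_top_iff f.toRingHom (mapCoord f.toRingHom) (proj0 R rows) (proj0 R' rows)
        Data.proj0_mapCoord,
      map_span_eq_top_iff f.toRingHom (mapCoord f.toRingHom) (proj1 R) (proj1 R')
        Data.proj1_mapCoord]
    change _ ↔ Ideal.map f.toRingHom _ = ⊤
    rw [Ideal.map_mul]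
    constructor
    · rintro ⟨h0, h1⟩
      rw [h0, h1, Ideal.top_mul]
    · intro h
      exact ⟨top_le_iff.1 (h ▸ Ideal.mul_le_left), top_le_iff.1 (h ▸ Ideal.mul_le_right)⟩

variable {κ : Type u} [Field κ] [Algebra OF κ]

theorem mem_coord1_of_fil1_eq {p : H.Pair κ} (h1 : p.fil1 = H.lambdaPrimeR κ) {x : Coord h κ} :
    x ∈ p.coord1 ↔ x.2 (some none) = 0 ∧ x.1 (some none) = 0 ∧
      ∀ k, x.1 (some (some k)) = -(algebraMap OF κ H.ϖ * x.2 (some (some k))) := by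
  rw [mem_coord1, h1, mem_lambdaPrimeR, LinearEquiv.apply_symm_apply]

/-- At `π = 0` the origin of each chart is a point of the form `(ℱ₀, Λ')`. -/
theorem exists_point_lambdaPrime (hz : IsUniversal H.ϖ rows z) (h0 : algebraMap OF κ H.ϖ = 0) :
    ∃ p : H.Pair κ, p.IsPoint (q + 1) ∧ p.fil1 = H.lambdaPrimeR κ ∧ (ofData H z).InChart p := by
  classical
  let y : Data h q κ :=
    { w := 0
      d := 0
      D := 0
      M := Matrix.of fun k j => if ∃ p, rows p = k ∧ j = p.succ then 1 else 0 }
  have hy : y.Valid (algebraMap OF κ H.ϖ) rows := by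
    refine ⟨fun p j => ?_, fun p p' => ?_, fun p p' => ?_⟩
    · simp [y]
    · simp [y]
    · simp [y, h0]
  refine ⟨ofData H y, isPoint_ofData hy, ?_, (inChart_ofData_iff hz _).2 ⟨y, hy, rfl⟩⟩
  have hM : ∀ k, y.M k 0 = 0 := fun k => by
    simp [y, (Fin.succ_ne_zero _).symm]
  have hcol : y.col 0 = Pi.single none 1 := by
    funext i
    match i with
    | none => simp
    | some none => simp [y]
    | some (some k) => simp [hM]
  ext x
  rw [mem_lambdaPrimeR]
  change H.toCoord κ x ∈ y.fil1 _ ↔ _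
  rw [Data.mem_fil1, h0]
  have hsp : ∀ c : Idx h → κ, sp (y.col 0) c = -c (some none) := fun c => by
    rw [hcol]; simp [sp_apply, midForm_apply]
  simp only [hsp, mul_zero, zero_smul, add_zero, zero_mul, neg_zero]
  constructor
  · rintro ⟨ψ, h1, h2, h3⟩
    have hψ : ∀ k : Fin q, ψ k.succ = 0 := fun k => by
      rw [h3]; simp [y]
    have hx : (H.toCoord κ x).1 = ψ 0 • Pi.single none 1 := by
      rw [h1, Data.comb_apply, Fin.sum_univ_succ, hcol]
      simp [hψ]
    refine ⟨by simpa [y] using h2, ?_, fun k => ?_⟩ <;> simp [hx]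
  · rintro ⟨h1, h2, h3⟩
    refine ⟨Pi.single 0 ((H.toCoord κ x).1 none), ?_, by simp [h1, y], fun k => by simp [y]⟩
    rw [Data.comb_apply, Fin.sum_univ_succ, hcol]
    funext i
    match i with
    | none => simp
    | some none => simp [h2]
    | some (some k) => simp [h3]

theorem finrank_of_isSummandOfRank {P : Type u} [AddCommGroup P] [Module κ P] {N : Submodule κ P}
    {k : ℕ} (hN : IsSummandOfRank k N) : Module.finrank κ N = k := by
  have := hN.2 ⊥
  rwa [Module.rankAtStalk_eq_finrank_of_free] at this

/-- A point of the form `(ℱ₀, Λ')` lies over `π = 0`: otherwise `(t + π) Λ'`, which is contained in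
`ℱ₀`, has rank `n - 1`. -/
theorem algebraMap_eq_zero_of_fil1_eq (hq : q < 2 * h) {p : H.Pair κ} (hp : p.IsPoint (q + 1))
    (h1 : p.fil1 = H.lambdaPrimeR κ) : algebraMap OF κ H.ϖ = 0 := by
  by_contra hne
  have hflag := hp.isFlag
  -- `L` parametrizes `(t + π) Λ'`, and `x` below is a preimage of `L v` under `t + π`
  let L : (Option (Fin (2 * h)) → κ) →ₗ[κ] Coord h κ :=
    { toFun := fun v => (0, fun i => match i with
        | none => v none
        | some none => 0
        | some (some k) => v (some k))
      map_add' := fun v w => by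
        ext i
        · simp
        · match i with
          | none => rfl
          | some none => simp
          | some (some k) => rfl
      map_smul' := fun r v => by
        ext i
        · simp
        · match i with
          | none => rfl
          | some none => simp
          | some (some k) => rfl }
  have hL : ∀ v, (H.toCoord κ).symm (L v) ∈ p.fil0 := by
    intro v
    rw [← mem_coord0]
    let x : Coord h κ := (fun i => match i with
        | none => v none
        | some none => 0
        | some (some k) => -v (some k), fun i => match i with
        | none => 0
        | some none => 0
        | some (some k) => (algebraMap OF κ H.ϖ)⁻¹ * v (some k))
    have hx : x ∈ p.coord1 := by
      rw [mem_coord1_of_fil1_eq h1]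
      refine ⟨rfl, rfl, fun k => ?_⟩
      simp only [x]
      rw [mul_inv_cancel_left₀ hne]
    convert hflag.add_mem x hx using 1
    ext i
    · rfl
    · match i with
      | none => simp [L, x]
      | some none => simp [L, x]
      | some (some k) =>
        simp only [L, x, LinearMap.coe_mk, AddHom.coe_mk, Pi.add_apply, Pi.smul_apply, smul_eq_mul]
        field_simp
        ring
  have : Module.Finite κ (H.LamR κ) := Module.Finite.of_basis (H.basisR κ)
  let L' : (Option (Fin (2 * h)) → κ) →ₗ[κ] p.fil0 :=
    LinearMap.codRestrict p.fil0 ((H.toCoord κ).symm.toLinearMap ∘ₗ L) hL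
  have hinj : Function.Injective L' := by
    rw [injective_iff_map_eq_zero]
    intro v hv
    have h3 : L v = 0 := (H.toCoord κ).symm.map_eq_zero_iff.1 (congrArg Subtype.val hv)
    funext i
    match i with
    | none => exact congrFun (congrArg Prod.snd h3) none
    | some k => exact congrFun (congrArg Prod.snd h3) (some (some k))
  have h4 := LinearMap.finrank_le_finrank_of_injective hinj
  rw [finrank_of_isSummandOfRank hp.rank0] at h4
  simp at h4
  omega

/-- A point of the form `(ℱ₀, Λ')` lies in one of the charts. -/
theorem exists_rows_inChart {p : H.Pair κ} (hp : p.IsPoint (q + 1))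
    (h1 : p.fil1 = H.lambdaPrimeR κ) (h0 : algebraMap OF κ H.ϖ = 0) :
    ∃ rows : Fin q ↪ Fin (2 * h), ∀ {C : Type u} [CommRing C] [Algebra OF C] {z : Data h q C},
      IsUniversal H.ϖ rows z → (ofData H z).InChart p := by
  have : Module.Finite κ (H.LamR κ) := Module.Finite.of_basis (H.basisR κ)
  have hmem1 : ∀ x : Coord h κ, x ∈ p.coord1 ↔ x.2 (some none) = 0 ∧ x.1 (some none) = 0 ∧
      ∀ k, x.1 (some (some k)) = 0 := fun x => by
    rw [mem_coord1_of_fil1_eq h1, h0]; simp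
  have hfr0 : Module.finrank κ p.coord0 = q + 1 :=
    (LinearEquiv.finrank_map_eq (H.toCoord κ) p.fil0).trans (finrank_of_isSummandOfRank hp.rank0)
  obtain ⟨rows, h2, h3, h4⟩ := exists_rows_of_isFlag hp.isFlag hmem1 hfr0
  exact ⟨rows, fun hz => inChart_of_map_eq_top hz hp.isFlag h2 h3 h4⟩

end chart

end Pair
end SplitHermitian

/-! ### From functors to open subschemes -/

section schemes

/-- Factorizations through a monomorphism glue. -/
theorem exists_factorization_of_openCover {X Y U : Scheme.{u}} (j : Y ⟶ X) [Mono j] (ι : U ⟶ X)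
    (𝒰 : U.OpenCover) (h : ∀ i, ∃ k : 𝒰.X i ⟶ Y, k ≫ j = 𝒰.f i ≫ ι) :
    ∃ s : U ⟶ Y, s ≫ j = ι := by
  choose k hk using h
  refine ⟨𝒰.glueMorphisms k fun i i' => ?_, 𝒰.hom_ext _ _ fun i => ?_⟩
  · rw [← cancel_mono j, Category.assoc, Category.assoc, hk, hk, pullback.condition_assoc]
  · rw [Scheme.Cover.ι_glueMorphisms_assoc, hk]

theorem exists_section_iSup {X Y : Scheme.{u}} (j : Y ⟶ X) [Mono j] {J : Type u} (U : J → X.Opens)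
    (hU : ∀ i, ∃ k : (U i).toScheme ⟶ Y, k ≫ j = (U i).ι) :
    ∃ s : (⨆ i, U i).toScheme ⟶ Y, s ≫ j = (⨆ i, U i).ι := by
  refine exists_factorization_of_openCover j _ (Scheme.Opens.iSupOpenCover U) fun i => ?_
  obtain ⟨k, hk⟩ := hU i
  exact ⟨k, hk.trans (Scheme.homOfLE_ι _ (le_iSup U i)).symm⟩

/-- A monomorphism with a section over an open subscheme that contains its image is an isomorphism
onto this open subscheme. -/
def isoOfSection {X Y : Scheme.{u}} (j : Y ⟶ X) [Mono j] (U : X.Opens)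
    (hj : Set.range j ⊆ U) (s : U.toScheme ⟶ Y) (hs : s ≫ j = U.ι) : U.toScheme ≅ Y where
  hom := s
  inv := IsOpenImmersion.lift U.ι j (by rw [Scheme.Opens.range_ι]; exact hj)
  hom_inv_id := by
    rw [← cancel_mono U.ι, Category.assoc, IsOpenImmersion.lift_fac, hs, Category.id_comp]
  inv_hom_id := by
    rw [← cancel_mono j, Category.assoc, hs, IsOpenImmersion.lift_fac, Category.id_comp]

end schemes

namespace SplitHermitian

variable {O₀ F₀ OF F V : Type u}
  [CommRing O₀] [IsDomain O₀] [IsDiscreteValuationRing O₀]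
  [Field F₀] [Algebra O₀ F₀] [IsFractionRing O₀ F₀]
  [Field F] [Algebra F₀ F] [Algebra O₀ F] [IsScalarTower O₀ F₀ F]
  [CommRing OF] [Algebra O₀ OF] [Algebra OF F] [IsScalarTower O₀ OF F] [IsIntegralClosure OF O₀ F]
  [AddCommGroup V] [Module F V] [Module OF V] [IsScalarTower OF F V]
  [Module O₀ V] [IsScalarTower O₀ OF V] {m s : ℕ} {H : SplitHermitian O₀ F₀ OF F V m}
  {X : Over (Spec (CommRingCat.of OF))} (ρ : H.Represents s X)
  {B : Type u} [CommRing B] [Algebra OF B] {u : H.Pair B}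

namespace Represents

theorem equiv_comp {R R' : Type u} [CommRing R] [Algebra OF R] [CommRing R'] [Algebra OF R']
    (f : R →ₐ[OF] R') (g : {g : Spec (CommRingCat.of R) ⟶ X.left //
      g ≫ X.hom = Spec.map (CommRingCat.ofHom (algebraMap OF R))})
    (g' : {g : Spec (CommRingCat.of R') ⟶ X.left //
      g ≫ X.hom = Spec.map (CommRingCat.ofHom (algebraMap OF R'))})
    (h : Spec.map (CommRingCat.ofHom f.toRingHom) ≫ g.1 = g'.1) :
    (ρ.equiv R' g').1 = (ρ.equiv R g).1.map f :=
  ρ.natural R R' f g g' h.symm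

theorem specMap_comp {R R' : Type u} [CommRing R] [Algebra OF R] [CommRing R'] [Algebra OF R']
    (f : R →ₐ[OF] R') {g : Spec (CommRingCat.of R) ⟶ X.left}
    (hg : g ≫ X.hom = Spec.map (CommRingCat.ofHom (algebraMap OF R))) :
    (Spec.map (CommRingCat.ofHom f.toRingHom) ≫ g) ≫ X.hom =
      Spec.map (CommRingCat.ofHom (algebraMap OF R')) := by
  rw [Category.assoc, hg, ← Spec.map_comp, ← CommRingCat.ofHom_comp]
  congr 2
  exact f.comp_algebraMap

/-- The morphism `Spec B → X` defined by a point `u ∈ ℳ(B)`. -/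
def chartMap (hu : u.IsPoint s) : Spec (CommRingCat.of B) ⟶ X.left := ((ρ.equiv B).symm ⟨u, hu⟩).1

theorem chartMap_hom (hu : u.IsPoint s) :
    ρ.chartMap hu ≫ X.hom = Spec.map (CommRingCat.ofHom (algebraMap OF B)) :=
  ((ρ.equiv B).symm ⟨u, hu⟩).2

/-- Every morphism over `O_F` from a spectrum to the chart comes from a homomorphism. -/
theorem exists_algHom {R : Type u} [CommRing R] [Algebra OF R]
    (k : Spec (CommRingCat.of R) ⟶ Spec (CommRingCat.of B))
    (hk : k ≫ Spec.map (CommRingCat.ofHom (algebraMap OF B)) =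
      Spec.map (CommRingCat.ofHom (algebraMap OF R))) :
    ∃ f : B →ₐ[OF] R, k = Spec.map (CommRingCat.ofHom f.toRingHom) := by
  obtain ⟨φ, rfl⟩ := Spec.map_surjective k
  rw [← Spec.map_comp] at hk
  have h := Spec.map_injective hk
  exact ⟨{ φ.hom with commutes' := fun a => congrArg (fun ψ => ψ.hom a) h }, rfl⟩

theorem equiv_chartMap (hu : u.IsPoint s) {R : Type u} [CommRing R] [Algebra OF R]
    (f : B →ₐ[OF] R) :
    (ρ.equiv R ⟨_, specMap_comp f (ρ.chartMap_hom hu)⟩).1 = u.map f := by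
  rw [ρ.equiv_comp f ((ρ.equiv B).symm ⟨u, hu⟩) _ rfl, Equiv.apply_symm_apply]

/-- An `R`-valued point of `X` lies in the chart if and only if it factors through `Spec B → X`. -/
theorem inChart_iff (hu : u.IsPoint s) {R : Type u} [CommRing R] [Algebra OF R]
    (g : {g : Spec (CommRingCat.of R) ⟶ X.left //
      g ≫ X.hom = Spec.map (CommRingCat.ofHom (algebraMap OF R))}) :
    u.InChart (ρ.equiv R g).1 ↔
      ∃ k : Spec (CommRingCat.of R) ⟶ Spec (CommRingCat.of B), k ≫ ρ.chartMap hu = g.1 := by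
  constructor
  · rintro ⟨f, hf⟩
    refine ⟨Spec.map (CommRingCat.ofHom f.toRingHom), ?_⟩
    rw [← ρ.equiv_chartMap hu f] at hf
    exact congrArg Subtype.val ((ρ.equiv R).injective (Subtype.ext hf)).symm
  · rintro ⟨k, hk⟩
    obtain ⟨f, rfl⟩ := exists_algHom k (by rw [← ρ.chartMap_hom hu, ← g.2, ← hk, Category.assoc])
    refine ⟨f, ?_⟩
    rw [← ρ.equiv_chartMap hu f]
    congr 2
    exact Subtype.ext hk.symm

theorem mono_chartMap (hu : u.IsOpenChart s) : Mono (ρ.chartMap hu.isPoint) := by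
  refine ⟨fun {Z} a b hab => Z.affineOpenCover.openCover.hom_ext _ _ fun i => ?_⟩
  obtain ⟨R, a', b', ha, hb⟩ : ∃ (R : CommRingCat.{u}) (a' b' : Spec R ⟶ Spec (CommRingCat.of B)),
      (a' ≫ ρ.chartMap hu.isPoint = b' ≫ ρ.chartMap hu.isPoint) ∧
      (a' = b' → Z.affineOpenCover.openCover.f i ≫ a = Z.affineOpenCover.openCover.f i ≫ b) :=
    ⟨_, Z.affineOpenCover.f i ≫ a, Z.affineOpenCover.f i ≫ b,
      by rw [Category.assoc, hab, Category.assoc], id⟩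
  refine hb ?_
  obtain ⟨φ, hφ⟩ := Spec.map_surjective (a' ≫ ρ.chartMap hu.isPoint ≫ X.hom)
  let _ : Algebra OF R := φ.hom.toAlgebra
  obtain ⟨f, rfl⟩ := exists_algHom (R := R) a' (by
    rw [← ρ.chartMap_hom hu.isPoint]; exact hφ.symm)
  obtain ⟨f', rfl⟩ := exists_algHom (R := R) b' (by
    rw [← ρ.chartMap_hom hu.isPoint, ← Category.assoc, ← ha, Category.assoc]; exact hφ.symm)
  have : f = f' := hu.injective R (by
    change u.map f = u.map f'
    rw [← ρ.equiv_chartMap hu.isPoint f, ← ρ.equiv_chartMap hu.isPoint f']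
    congr 2
    exact Subtype.ext ha)
  rw [this]

/-- Around each point of its image, `Spec B → X` has a section. On an affine open `V = Spec R`, the
chart is the complement of some `V(I)`, and the point lies in `D(a)` for some `a ∈ I`, over which
the tautological point of `X` lies in the chart. -/
theorem exists_section (hu : u.IsOpenChart s) (x : Spec (CommRingCat.of B)) :
    ∃ W : X.left.Opens, ρ.chartMap hu.isPoint x ∈ W ∧
      ∃ k : W.toScheme ⟶ Spec (CommRingCat.of B), k ≫ ρ.chartMap hu.isPoint = W.ι := by
  obtain ⟨V, hV, hjV, -⟩ := exists_isAffineOpen_mem_and_subset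
    (TopologicalSpace.Opens.mem_top (ρ.chartMap hu.isPoint x))
  obtain ⟨φ, hφ⟩ := Spec.map_surjective (hV.fromSpec ≫ X.hom)
  let _ : Algebra OF Γ(X.left, V) := φ.hom.toAlgebra
  let g : {g : Spec (CommRingCat.of Γ(X.left, V)) ⟶ X.left //
      g ≫ X.hom = Spec.map (CommRingCat.ofHom (algebraMap OF Γ(X.left, V)))} :=
    ⟨hV.fromSpec, hφ.symm⟩
  obtain ⟨I, hI⟩ := hu.isOpen _ (ρ.equiv _ g).1 (ρ.equiv _ g).2
  let l := (Spec (CommRingCat.of B)).fromSpecResidueField x ≫ ρ.chartMap hu.isPoint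
  have hlx : ∀ y, l y = ρ.chartMap hu.isPoint x := fun y => by
    simp only [l, Scheme.Hom.comp_apply, Scheme.fromSpecResidueField_apply]
  have hl : Set.range l ⊆ Set.range hV.fromSpec := by
    rw [hV.range_fromSpec]
    rintro _ ⟨y, rfl⟩
    rw [hlx]; exact hjV
  obtain ⟨θ, hθ⟩ := Spec.map_surjective (IsOpenImmersion.lift hV.fromSpec l hl)
  have hθl : Spec.map θ ≫ hV.fromSpec = l := by rw [hθ, IsOpenImmersion.lift_fac]
  let K := (Spec (CommRingCat.of B)).residueField x
  let _ : Algebra OF K := (θ.hom.comp φ.hom).toAlgebra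
  let f : Γ(X.left, V) →ₐ[OF] K := { θ.hom with commutes' := fun _ => rfl }
  have h1 : u.InChart ((ρ.equiv _ g).1.map f) := by
    rw [← ρ.equiv_comp f g ⟨_, specMap_comp f g.2⟩ rfl, ρ.inChart_iff hu.isPoint]
    exact ⟨(Spec (CommRingCat.of B)).fromSpecResidueField x, hθl.symm⟩
  have h2 := (hI K f).1 h1
  obtain ⟨a, ha, hne⟩ : ∃ a ∈ I, θ.hom a ≠ 0 := by
    by_contra! hcon
    refine (bot_ne_top : (⊥ : Ideal K) ≠ ⊤) ?_
    rw [← h2, eq_comm, eq_bot_iff, Ideal.map_le_iff_le_comap]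
    exact fun a ha => hcon a ha
  have hW := hV.basicOpen a
  refine ⟨X.left.basicOpen a, ?_, ?_⟩
  · let y : Spec K := (⊥ : PrimeSpectrum K)
    have h3 : Spec.map θ y ∈ hV.fromSpec ⁻¹ᵁ X.left.basicOpen a := by
      rw [hV.fromSpec_preimage_basicOpen]
      exact hne
    have h4 : hV.fromSpec (Spec.map θ y) = ρ.chartMap hu.isPoint x := by
      rw [← Scheme.Hom.comp_apply, hθl, hlx]
    rw [← h4]
    exact h3
  · let res := X.left.presheaf.map (homOfLE (X.left.basicOpen_le a)).op
    let _ : Algebra OF Γ(X.left, X.left.basicOpen a) := (res.hom.comp φ.hom).toAlgebra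
    let f' : Γ(X.left, V) →ₐ[OF] Γ(X.left, X.left.basicOpen a) :=
      { res.hom with commutes' := fun _ => rfl }
    have h3 : I.map f' = ⊤ := Ideal.eq_top_of_isUnit_mem _ (Ideal.mem_map_of_mem f' ha)
      (RingedSpace.isUnit_res_basicOpen _ a)
    have h4 := (hI _ f').2 h3
    rw [← ρ.equiv_comp f' g ⟨_, specMap_comp f' g.2⟩ rfl, ρ.inChart_iff hu.isPoint] at h4
    obtain ⟨k, hk⟩ := h4
    refine ⟨hW.isoSpec.hom ≫ k, ?_⟩
    rw [Category.assoc, hk, ← hW.isoSpec_hom_fromSpec, ← hV.map_fromSpec hW]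
    rfl

/-- An open chart in the sense of functors is an affine open subscheme of the representing
scheme. -/
theorem exists_isAffineOpen (hu : u.IsOpenChart s) :
    ∃ U : X.left.Opens, IsAffineOpen U ∧
      (∃ α : U.toScheme ≅ Spec (CommRingCat.of B),
        α.hom ≫ Spec.map (CommRingCat.ofHom (algebraMap OF B)) = U.ι ≫ X.hom) ∧
      ∀ (R : Type u) [CommRing R] [Algebra OF R] (p : {p : H.Pair R // p.IsPoint s}),
        u.InChart p.1 ↔ Set.range ((ρ.equiv R).symm p).1 ⊆ U := by
  have := ρ.mono_chartMap hu
  let J := {W : X.left.Opens // ∃ k : W.toScheme ⟶ Spec (CommRingCat.of B),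
    k ≫ ρ.chartMap hu.isPoint = W.ι}
  obtain ⟨σ, hσ⟩ := exists_section_iSup (ρ.chartMap hu.isPoint) (fun W : J => W.1) fun W => W.2
  have hrange : Set.range (ρ.chartMap hu.isPoint) ⊆ (⨆ W : J, W.1 : X.left.Opens) := by
    rintro _ ⟨x, rfl⟩
    obtain ⟨W, hx, hW⟩ := ρ.exists_section hu x
    exact le_iSup (fun W : J => W.1) ⟨W, hW⟩ hx
  let α := isoOfSection _ _ hrange σ hσ
  refine ⟨⨆ W : J, W.1, IsAffine.of_isIso α.hom, ⟨α, ?_⟩, fun R _ _ p => ?_⟩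
  · rw [← ρ.chartMap_hom hu.isPoint, ← Category.assoc]
    exact congrArg (· ≫ X.hom) hσ
  · have h := ρ.inChart_iff hu.isPoint ((ρ.equiv R).symm p)
    rw [Equiv.apply_symm_apply] at h
    rw [h]
    constructor
    · rintro ⟨k, hk⟩
      rw [← hk]
      rintro _ ⟨y, rfl⟩
      exact hrange ⟨k y, (Scheme.Hom.comp_apply _ _ _).symm⟩
    · intro hp
      refine ⟨IsOpenImmersion.lift (⨆ W : J, W.1 : X.left.Opens).ι ((ρ.equiv R).symm p).1
        (by rw [Scheme.Opens.range_ι]; exact hp) ≫ σ, ?_⟩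
      rw [Category.assoc, hσ, IsOpenImmersion.lift_fac]

end Represents
end SplitHermitian

section affineSpace

/-- `Spec (A[X_1, …, X_k] ⊗ C)` is the product of affine `k`-space and `Spec C` over `Spec A`. -/
theorem exists_iso_pullback_affineSpace (k : ℕ) (A C : Type u) [CommRing A] [CommRing C]
    [Algebra A C] :
    ∃ β : Spec (CommRingCat.of (MvPolynomial (Fin k) A ⊗[A] C)) ≅
        pullback (𝔸(ULift.{u} (Fin k); Spec (CommRingCat.of A)) ↘ Spec (CommRingCat.of A))
          (Spec.map (CommRingCat.ofHom (algebraMap A C))),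
      β.hom ≫ pullback.fst _ _ ≫
          (𝔸(ULift.{u} (Fin k); Spec (CommRingCat.of A)) ↘ Spec (CommRingCat.of A)) =
        Spec.map (CommRingCat.ofHom (algebraMap A (MvPolynomial (Fin k) A ⊗[A] C))) := by
  let ε : MvPolynomial (ULift.{u} (Fin k)) A ≃ₐ[A] MvPolynomial (Fin k) A :=
    MvPolynomial.renameEquiv A Equiv.ulift
  let e : Spec (CommRingCat.of (MvPolynomial (Fin k) A)) ≅
      𝔸(ULift.{u} (Fin k); Spec (CommRingCat.of A)) :=
    Scheme.Spec.mapIso ε.toRingEquiv.toCommRingCatIso.op ≪≫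
      (AffineSpace.SpecIso (ULift.{u} (Fin k)) (CommRingCat.of A)).symm
  have he : e.hom ≫ (𝔸(ULift.{u} (Fin k); Spec (CommRingCat.of A)) ↘ Spec (CommRingCat.of A)) =
      Spec.map (CommRingCat.ofHom (algebraMap A (MvPolynomial (Fin k) A))) := by
    simp only [e, Iso.trans_hom, Iso.symm_hom, Category.assoc, AffineSpace.SpecIso_inv_over]
    change Spec.map (CommRingCat.ofHom ε.toRingEquiv.toRingHom) ≫ _ = _
    rw [← Spec.map_comp, ← CommRingCat.ofHom_comp]
    congr 2
    exact ε.toAlgHom.comp_algebraMap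
  refine ⟨(pullbackSpecIso A (MvPolynomial (Fin k) A) C).symm ≪≫
    asIso (pullback.map _ _ _ _ e.hom (𝟙 _) (𝟙 _) (by rw [he, Category.comp_id])
      (by rw [Category.comp_id, Category.id_comp])), ?_⟩
  simp only [Iso.trans_hom, Iso.symm_hom, asIso_hom, Category.assoc]
  rw [pullback.lift_fst_assoc, Category.assoc, he, pullbackSpecIso_inv_fst_assoc, ← Spec.map_comp,
    ← CommRingCat.ofHom_comp]

end affineSpace

end

theorem theorem4p8
    (O₀ F₀ OF F V : Type u)
    [CommRing O₀] [IsDomain O₀] [IsDiscreteValuationRing O₀]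
    [IsAdicComplete (IsLocalRing.maximalIdeal O₀) O₀]
    [PerfectField (IsLocalRing.ResidueField O₀)]
    [Field F₀] [Algebra O₀ F₀] [IsFractionRing O₀ F₀]
    [Field F] [Algebra F₀ F] [Algebra O₀ F] [IsScalarTower O₀ F₀ F]
    [CommRing OF] [Algebra O₀ OF] [Algebra OF F] [IsScalarTower O₀ OF F]
    [IsIntegralClosure OF O₀ F]
    [AddCommGroup V] [Module F V] [Module OF V] [IsScalarTower OF F V]
    [Module O₀ V] [IsScalarTower O₀ OF V]
    (m r s : ℕ) (hrs : r + s = 2 * m) (hsr : s ≤ r) (hs : 2 ≤ s)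
    (H : SplitHermitian O₀ F₀ OF F V m) :
    ∃ u : ∀ rows : Fin (s - 1) ↪ Fin (2 * (m - 1)),
        H.Pair (MvPolynomial (Fin s) OF ⊗[OF]
          ChartEquations.Ring OF (m - 1) (s - 1) H.ϖ rows),
      -- each `u rows` is an affine chart `𝔸^s × Spec O_F[D, M₂]/I` of `ℳ`
      (∀ rows, (u rows).IsOpenChart s) ∧
      -- each chart contains a point `(ℱ₀, Λ')`, over any field over the residue field of `O_F`
      (∀ rows (κ : Type u) [Field κ] [Algebra OF κ], algebraMap OF κ H.ϖ = 0 →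
        ∃ p : H.Pair κ, p.IsPoint s ∧ p.fil1 = H.lambdaPrimeR κ ∧ (u rows).InChart p) ∧
      -- each point `(ℱ₀, Λ')` lies in one of the charts
      (∀ (κ : Type u) [Field κ] [Algebra OF κ] (p : H.Pair κ), p.IsPoint s →
        p.fil1 = H.lambdaPrimeR κ → ∃ rows, (u rows).InChart p) ∧
      -- the charts as open subschemes of the scheme `X` that represents `ℳ`
      (∀ (X : Over (Spec (CommRingCat.of OF))) (ρ : H.Represents s X) (rows),
        ∃ U : X.left.Opens, IsAffineOpen U ∧
          (∃ α : U.toScheme ≅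
              pullback (𝔸(ULift.{u} (Fin s); Spec (CommRingCat.of OF)) ↘ Spec (CommRingCat.of OF))
                (Spec.map (CommRingCat.ofHom
                  (algebraMap OF (ChartEquations.Ring OF (m - 1) (s - 1) H.ϖ rows)))),
            α.hom ≫ pullback.fst _ _ ≫
                (𝔸(ULift.{u} (Fin s); Spec (CommRingCat.of OF)) ↘ Spec (CommRingCat.of OF)) =
              U.ι ≫ X.hom) ∧
          ∀ (R : Type u) [CommRing R] [Algebra OF R] (p : {p : H.Pair R // p.IsPoint s}),
            (u rows).InChart p.1 ↔ Set.range ((ρ.equiv R).symm p).1 ⊆ U) := by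
  obtain ⟨h, rfl⟩ : ∃ h, m = h + 1 := ⟨m - 1, by omega⟩
  obtain ⟨q, rfl⟩ : ∃ q, s = q + 1 := ⟨s - 1, by omega⟩
  have hchart : ∀ rows : Fin q ↪ Fin (2 * h), (SplitHermitian.Pair.ofData H
      (ChartCoord.univData H.ϖ rows)).IsOpenChart (q + 1) := fun rows =>
    SplitHermitian.Pair.ofData_isOpenChart (ChartCoord.univData_isUniversal H.ϖ rows)
  refine ⟨fun rows => SplitHermitian.Pair.ofData H (ChartCoord.univData H.ϖ rows), hchart,
    fun rows κ _ _ h0 => SplitHermitian.Pair.exists_point_lambdaPrime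
      (ChartCoord.univData_isUniversal H.ϖ rows) h0, fun κ _ _ p hp h1 => ?_, fun X ρ rows => ?_⟩
  · have h0 := SplitHermitian.Pair.algebraMap_eq_zero_of_fil1_eq (by omega) hp h1
    obtain ⟨rows, hrows⟩ := SplitHermitian.Pair.exists_rows_inChart hp h1 h0
    exact ⟨rows, hrows (ChartCoord.univData_isUniversal H.ϖ rows)⟩
  · obtain ⟨U, hU, ⟨α, hα⟩, hUp⟩ := ρ.exists_isAffineOpen (hchart rows)
    obtain ⟨β, hβ⟩ := exists_iso_pullback_affineSpace (q + 1) OF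
      (ChartEquations.Ring OF h q H.ϖ rows)
    exact ⟨U, hU, ⟨α ≪≫ β, by rw [Iso.trans_hom, Category.assoc, hβ]; exact hα⟩, hUp⟩
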